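/- Let $n\ge 1$, let $\Omega\subset\mathbb{R}^n$ be a bounded open set, let $\alpha,\beta,\gamma,\kappa>0$ and $\tau\in[0,1]$. Let $A=-\Delta$ be the Dirichlet Laplacian on the complex Hilbert space $L^2=L^2(\Omega)$, with $D(A)=\{u\in H^1_0(\Omega):\Delta u\in L^2(\Omega)\}$ (which is $H^2(\Omega)\cap H^1_0(\Omega)$ if $\partial\Omega$ is sufficiently smooth), and for $s\ge 0$ let $A^s$ be its power, with domain $D(A^s)$. Let $D(A^{-\tau/2})$ be the dual space of $D(A^{\tau/2})$, define $I+\gamma A^\tau:D(A^{\tau/2})\to D(A^{-\tau/2})$ by $\langle (I+\gamma A^\tau)z,w\rangle=\langle z,w\rangle+\gamma\langle A^{\tau/2}z,A^{\tau/2}w\rangle$, and for $w\in D(A^{1-\tau/2})$ let $Aw\in D(A^{-\tau/2})$ be given by $\langle Aw,z\rangle=\langle A^{1-\tau/2}w,A^{\tau/2}z\rangle$. Let $\mathbb{H}=D(A)\times D(A^{\tau/2})\times L^2$ with the inner product $$\langle U_1,U_2\rangle_{\mathbb H}=\beta\langle Au_1,Au_2\rangle+\beta\big(\langle v_1,v_2\rangle+\gamma\langle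 A^{\tau/2}v_1,A^{\tau/2}v_2\rangle\big)+\alpha\langle\theta_1,\theta_2\rangle,\qquad U_i=(u_i,v_i,\theta_i),$$ and let $\mathbb{B}$ be the operator on $\mathbb{H}$ with domain $$D(\mathbb{B})=\{(u,v,\theta)\in\mathbb{H}:\ v\in D(A),\ -Au+\alpha\theta\in D(A^{1-\tau/2}),\ -\kappa\theta-\beta v\in D(A)\}$$ and $$\mathbb{B}(u,v,\theta)=\big(v,\ (I+\gamma A^\tau)^{-1}A(-Au+\alpha\theta),\ A(-\kappa\theta-\beta v)\big).$$ Then $\mathbb{H}$ is a Hilbert space, $\mathbb{B}$ is well defined on $D(\mathbb{B})$, and $\mathbb{B}$ is the infinitesimal generator of a $C_0$-semigroup of contractions $(S(t))_{t\ge0}$ on $\mathbb{H}$. For every $U_0\in\mathbb{H}$ there is a unique weak solution $U\in C([0,\infty),\mathbb{H})$ of $\frac{d}{dt}U=\mathbb{B}U$, $U(0)=U_0$, that is, a unique $U\in C([0,\infty),\mathbb{H})$ with $U(0)=U_0$ such that $\frac{d}{dt}\langle U(t),V\rangle_{\mathbb H}=\langle U(t),\mathbb{B}^*V\rangle_{\mathbb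 H}$ for all $t\ge0$ and all $V\in D(\mathbb{B}^*)$; it is $U(t)=S(t)U_0$. If moreover $k\in\mathbb{N}$ and $U_0\in D(\mathbb{B}^k)$, then $U\in\bigcap_{j=0}^{k}C^{k-j}([0,\infty),D(\mathbb{B}^j))$, where $D(\mathbb{B}^j)$ carries the graph norm of $\mathbb{B}^j$. -/

import Mathlib

open MeasureTheory Set Filter Topology
open scoped NNReal ENNReal InnerProductSpace ContDiff

noncomputable section

namespace ThermoPlate

/-! ### The Dirichlet Laplacian on `L²(Ω)` -/

/-- The complex Hilbert space `L²(Ω)`. -/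
abbrev L2 {n : ℕ} (Ω : Set (EuclideanSpace ℝ (Fin n))) : Type :=
  Lp ℂ 2 (volume.restrict Ω)

/-- The pairs `(φ, ∇φ)` in `L²(Ω) × L²(Ω)ⁿ` with `φ` a complex test function, `φ ∈ C_c^∞(Ω)`. -/
def testPairs {n : ℕ} (Ω : Set (EuclideanSpace ℝ (Fin n))) :
    Submodule ℂ (L2 Ω × (Fin n → L2 Ω)) where
  carrier := {p | ∃ φ : EuclideanSpace ℝ (Fin n) → ℂ,
    ContDiff ℝ ∞ φ ∧ HasCompactSupport φ ∧ tsupport φ ⊆ Ω ∧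
    p.1 =ᵐ[volume.restrict Ω] φ ∧
    ∀ i, p.2 i =ᵐ[volume.restrict Ω] fun x => fderiv ℝ φ x (EuclideanSpace.single i 1)}
  add_mem' := by
    rintro ⟨p, q⟩ ⟨p', q'⟩ ⟨φ, h1, h2, h3, h4, h5⟩ ⟨φ', h1', h2', h3', h4', h5'⟩
    refine ⟨φ + φ', h1.add h1', h2.add h2', ?_, ?_, fun i => ?_⟩
    · exact (tsupport_add φ φ').trans (union_subset h3 h3')
    · exact (Lp.coeFn_add p p').trans (h4.add h4')
    · refine (Lp.coeFn_add (q i) (q' i)).trans (((h5 i).add (h5' i)).trans (.of_forall fun x => ?_))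
      have := fderiv_add (h1.differentiable (by simp) x) (h1'.differentiable (by simp) x)
      simp [this]
  zero_mem' := by
    refine ⟨0, contDiff_const, HasCompactSupport.zero, by simp [tsupport],
      Lp.coeFn_zero _ _ _, fun i => (Lp.coeFn_zero _ _ _).trans (.of_forall fun x => ?_)⟩
    simp
  smul_mem' := by
    rintro c ⟨p, q⟩ ⟨φ, h1, h2, h3, h4, h5⟩
    refine ⟨c • φ, h1.const_smul c, h2.smul_left (f := fun _ => c), ?_, ?_, fun i => ?_⟩
    · exact (closure_mono (Function.support_const_smul_subset c φ)).trans h3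
    · exact (Lp.coeFn_smul c p).trans (h4.const_smul c)
    · refine (Lp.coeFn_smul c (q i)).trans
        (((h5 i).const_smul c).trans (.of_forall fun x => ?_))
      have := fderiv_const_smul (h1.differentiable (by simp) x) c
      simp [this]

/-- The space `H¹₀(Ω)`, the closure of `C_c^∞(Ω)` in the `H¹` norm, each function `u` being
given together with its weak gradient, as the pair `(u, ∇u)`. -/
def H10 {n : ℕ} (Ω : Set (EuclideanSpace ℝ (Fin n))) : Submodule ℂ (L2 Ω × (Fin n → L2 Ω)) :=
  (testPairs Ω).topologicalClosure

/-- The graph of the Dirichlet Laplacian: the pairs `(u, f)` with `u ∈ H¹₀(Ω)`, `f ∈ L²(Ω)` and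
`-Δu = f` in the sense of distributions, that is, `∫ ∇φ̄ · ∇u = ∫ φ̄ f` for all
`φ ∈ C_c^∞(Ω)`. -/
def dirichletGraph {n : ℕ} (Ω : Set (EuclideanSpace ℝ (Fin n))) :
    Submodule ℂ (L2 Ω × L2 Ω) where
  carrier := {p | ∃ g : Fin n → L2 Ω, (p.1, g) ∈ H10 Ω ∧
    ∀ w ∈ testPairs Ω, ∑ i, ⟪w.2 i, g i⟫_ℂ = ⟪w.1, p.2⟫_ℂ}
  add_mem' := by
    rintro p p' ⟨g, h1, h2⟩ ⟨g', h1', h2'⟩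
    refine ⟨g + g', (H10 Ω).add_mem h1 h1', fun w hw => ?_⟩
    simp [inner_add_right, Finset.sum_add_distrib, h2 w hw, h2' w hw]
  zero_mem' := ⟨0, (H10 Ω).zero_mem, fun w _ => by simp⟩
  smul_mem' := by
    rintro c p ⟨g, h1, h2⟩
    refine ⟨c • g, (H10 Ω).smul_mem c h1, fun w hw => ?_⟩
    simp [inner_smul_right, ← Finset.mul_sum, h2 w hw]

/-- The Dirichlet Laplacian `A = -Δ` on `L²(Ω)`, with the domain
`D(A) = {u ∈ H¹₀(Ω) : Δu ∈ L²(Ω)}`. If `Ω` is bounded with a sufficiently smooth boundary, this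
domain is `H²(Ω) ∩ H¹₀(Ω)`. -/
def dirichletLaplacian {n : ℕ} (Ω : Set (EuclideanSpace ℝ (Fin n))) : L2 Ω →ₗ.[ℂ] L2 Ω :=
  (dirichletGraph Ω).toLinearPMap

theorem dirichletGraph_test {n : ℕ} {Ω : Set (EuclideanSpace ℝ (Fin n))} {f : L2 Ω}
    {g : Fin n → L2 Ω} (h : ∀ w ∈ testPairs Ω, ∑ i, ⟪w.2 i, g i⟫_ℂ = ⟪w.1, f⟫_ℂ) :
    ∀ w ∈ H10 Ω, ∑ i, ⟪w.2 i, g i⟫_ℂ = ⟪w.1, f⟫_ℂ := by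
  intro w hw
  have hc : IsClosed {w : L2 Ω × (Fin n → L2 Ω) | ∑ i, ⟪w.2 i, g i⟫_ℂ = ⟪w.1, f⟫_ℂ} :=
    isClosed_eq (by fun_prop) (by fun_prop)
  exact closure_minimal h hc hw

theorem eq_zero_of_sum_inner {n : ℕ} {Ω : Set (EuclideanSpace ℝ (Fin n))} {g : Fin n → L2 Ω}
    (h : ∑ i, ⟪g i, g i⟫_ℂ = 0) : g = 0 := by
  have h' : ∑ i, ‖g i‖ ^ 2 = 0 := by
    have h2 : ((∑ i, ‖g i‖ ^ 2 : ℝ) : ℂ) = 0 := by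
      rw [← h]; push_cast
      exact Finset.sum_congr rfl fun i _ => (inner_self_eq_norm_sq_to_K (g i)).symm
    exact_mod_cast h2
  rw [Finset.sum_eq_zero_iff_of_nonneg (fun i _ => by positivity)] at h'
  ext1 i
  simpa using h' i (Finset.mem_univ i)

theorem dirichletGraph_single {n : ℕ} {Ω : Set (EuclideanSpace ℝ (Fin n))} (hΩ : IsOpen Ω)
    (p : L2 Ω × L2 Ω) (hp : p ∈ dirichletGraph Ω) (h0 : p.1 = 0) : p.2 = 0 := by
  obtain ⟨u, f⟩ := p
  obtain ⟨g, h1, h2⟩ := hp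
  simp only at h0 h1 h2 ⊢
  subst h0
  have hg : g = 0 := by
    apply eq_zero_of_sum_inner
    simpa using dirichletGraph_test h2 _ h1
  subst hg
  have key : ∀ φ : EuclideanSpace ℝ (Fin n) → ℝ, ContDiff ℝ ∞ φ → HasCompactSupport φ →
      tsupport φ ⊆ Ω → ∫ x, φ x • f x ∂(volume.restrict Ω) = 0 := by
    intro φ c1 c2 c3
    have d1 : ContDiff ℝ ∞ (fun x => (φ x : ℂ)) := Complex.ofRealCLM.contDiff.comp c1
    have d2 : HasCompactSupport (fun x => (φ x : ℂ)) :=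
      c2.comp_left (g := fun r : ℝ => (r : ℂ)) (by simp)
    have d3 : tsupport (fun x => (φ x : ℂ)) ⊆ Ω := by
      refine (closure_mono ?_).trans c3
      intro x hx; simpa using hx
    have m1 : MemLp (fun x => (φ x : ℂ)) 2 (volume.restrict Ω) :=
      (d1.continuous.memLp_of_hasCompactSupport d2).restrict Ω
    have m2 : ∀ i, MemLp (fun x => fderiv ℝ (fun x => (φ x : ℂ)) x (EuclideanSpace.single i 1)) 2
        (volume.restrict Ω) := fun i =>
      (((d1.continuous_fderiv (by simp)).clm_apply continuous_const).memLp_of_hasCompactSupport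
        (d2.fderiv_apply ℝ _)).restrict Ω
    have := h2 (m1.toLp, fun i => (m2 i).toLp)
      ⟨_, d1, d2, d3, m1.coeFn_toLp, fun i => (m2 i).coeFn_toLp⟩
    simp only [Pi.zero_apply, inner_zero_right, Finset.sum_const_zero, L2.inner_def] at this
    rw [this]
    apply integral_congr_ae
    filter_upwards [m1.coeFn_toLp] with x hx
    rw [hx]
    simp [RCLike.inner_apply, mul_comm]
  have hloc : LocallyIntegrableOn f Ω (volume.restrict Ω) :=
    ((Lp.memLp f).locallyIntegrable (by norm_num)).locallyIntegrableOn Ω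
  have := hΩ.ae_eq_zero_of_integral_contDiff_smul_eq_zero hloc key
  apply Lp.ext
  filter_upwards [this, Lp.coeFn_zero ℂ 2 (volume.restrict Ω),
    ae_restrict_mem hΩ.measurableSet] with x h3 h4 h5
  rw [h3 h5, h4]; rfl

theorem pointwise_aux {z w : ℂ} {c R : ℝ} (h : z ≠ 0 → |c| ≤ R) :
    -(c * (2 * inner ℝ z w)) ≤ (1 / 2) * ‖z‖ ^ 2 + 2 * R ^ 2 * ‖w‖ ^ 2 := by
  have hb : |inner ℝ z w| ≤ ‖z‖ * ‖w‖ := abs_real_inner_le_norm _ _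
  by_cases hz : z = 0
  · subst hz
    simp only [inner_zero_left, mul_zero, neg_zero, norm_zero]
    positivity
  · have hc := h hz
    have h5 : -(c * (2 * inner ℝ z w)) ≤ 2 * (R * (‖z‖ * ‖w‖)) := by
      refine (neg_le_abs _).trans ?_
      rw [abs_mul, abs_mul, abs_two]
      have := mul_le_mul hc hb (abs_nonneg _) ((abs_nonneg _).trans hc)
      linarith
    nlinarith [sq_nonneg (‖z‖ - 2 * R * ‖w‖)]

/-- Poincaré's inequality for a smooth function with compact support in a slab. -/
theorem poincare_aux {n : ℕ} (i : Fin n) {R : ℝ} {φ : EuclideanSpace ℝ (Fin n) → ℂ}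
    (h1 : ContDiff ℝ ∞ φ) (h2 : HasCompactSupport φ) (hR : ∀ x ∈ tsupport φ, |x i| ≤ R) :
    ∫ x, ‖φ x‖ ^ 2 ≤ 4 * R ^ 2 * ∫ x, ‖fderiv ℝ φ x (EuclideanSpace.single i 1)‖ ^ 2 := by
  have ψ1 : ContDiff ℝ ∞ (fun x => ‖φ x‖ ^ 2) := h1.norm_sq ℝ
  have ψ2 : HasCompactSupport (fun x => ‖φ x‖ ^ 2) :=
    h2.comp_left (g := fun z : ℂ => ‖z‖ ^ 2) (by simp)
  have hd : ∀ x v, fderiv ℝ (fun x => ‖φ x‖ ^ 2) x v = 2 * inner ℝ (φ x) (fderiv ℝ φ x v) := by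
    intro x v
    have := ((h1.differentiable (by simp) x).hasFDerivAt.norm_sq).fderiv
    rw [this]; simp; ring
  generalize hψ : (fun x => ‖φ x‖ ^ 2) = ψ at ψ1 ψ2 hd
  have hψ' : ∀ x, ‖φ x‖ ^ 2 = ψ x := fun x => congrFun hψ x
  obtain ⟨v, hv⟩ : ∃ v : EuclideanSpace ℝ (Fin n), v = EuclideanSpace.single i 1 := ⟨_, rfl⟩
  rw [← hv]
  have cφ' : Continuous fun x => fderiv ℝ φ x v :=
    (h1.continuous_fderiv (by simp)).clm_apply continuous_const
  have cψ' : Continuous fun x => fderiv ℝ ψ x v :=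
    (ψ1.continuous_fderiv (by simp)).clm_apply continuous_const
  have sφ' : HasCompactSupport fun x => fderiv ℝ φ x v := h2.fderiv_apply ℝ v
  have sψ' : HasCompactSupport fun x => fderiv ℝ ψ x v := ψ2.fderiv_apply ℝ v
  have I1 : Integrable ψ := ψ1.continuous.integrable_of_hasCompactSupport ψ2
  have I2 : Integrable fun x => ‖fderiv ℝ φ x v‖ ^ 2 := by
    have e1 : Continuous fun x => ‖fderiv ℝ φ x v‖ ^ 2 := by fun_prop
    have e2 : HasCompactSupport fun x => ‖fderiv ℝ φ x v‖ ^ 2 := by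
      refine HasCompactSupport.of_support_subset_isCompact sφ'.isCompact fun x hx => ?_
      refine subset_tsupport _ fun h0 => hx ?_
      simp only [h0, norm_zero]; norm_num
    exact e1.integrable_of_hasCompactSupport e2
  obtain ⟨c, hc⟩ : ∃ c : EuclideanSpace ℝ (Fin n) →L[ℝ] ℝ, ∀ x, c x = x i :=
    ⟨EuclideanSpace.proj i, fun x => rfl⟩
  have cv : ∀ x, fderiv ℝ (fun x => c x) x v = 1 := fun x => by
    rw [ContinuousLinearMap.fderiv, hc, hv]; simp
  have I3 : Integrable fun x => c x * fderiv ℝ ψ x v :=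
    (c.continuous.mul cψ').integrable_of_hasCompactSupport (sψ'.mul_left)
  have I4 : Integrable fun x => c x * ψ x :=
    (c.continuous.mul ψ1.continuous).integrable_of_hasCompactSupport (ψ2.mul_left)
  have parts := integral_mul_fderiv_eq_neg_fderiv_mul_of_integrable (μ := volume)
    (f := fun x => c x) (g := ψ) (v := v) (by simpa only [cv, one_mul] using I1) I3 I4
    (fun x _ => c.differentiableAt) (fun x _ => ψ1.differentiable (by simp) x)
  simp only [cv, one_mul] at parts
  have hle : ∫ x, -(c x * fderiv ℝ ψ x v) ≤
      ∫ x, ((1 / 2) * ψ x + 2 * R ^ 2 * ‖fderiv ℝ φ x v‖ ^ 2) := by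
    refine integral_mono I3.neg ((I1.const_mul _).add (I2.const_mul _)) fun x => ?_
    simp only [hd, ← hψ', hc]
    exact pointwise_aux fun hx => hR x (subset_tsupport φ hx)
  rw [integral_neg, parts, neg_neg, integral_add (I1.const_mul _) (I2.const_mul _),
    integral_const_mul, integral_const_mul] at hle
  linarith

theorem norm_sq_eq_integral {n : ℕ} {Ω : Set (EuclideanSpace ℝ (Fin n))}
    {p : L2 Ω} {φ : EuclideanSpace ℝ (Fin n) → ℂ} (h : p =ᵐ[volume.restrict Ω] φ)
    (hs : Function.support φ ⊆ Ω) : ‖p‖ ^ 2 = ∫ x, ‖φ x‖ ^ 2 := by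
  rw [← inner_self_eq_norm_sq (𝕜 := ℂ) p, L2.inner_def,
    ← setIntegral_eq_integral_of_forall_compl_eq_zero (s := Ω) (f := fun x => ‖φ x‖ ^ 2)
      (fun x hx => by
        have : φ x = 0 := by
          by_contra hne
          exact hx (hs hne)
        simp [this])]
  have : ∫ x in Ω, ⟪p x, p x⟫_ℂ = ((∫ x in Ω, ‖φ x‖ ^ 2 : ℝ) : ℂ) := by
    rw [← integral_complex_ofReal]
    apply integral_congr_ae
    filter_upwards [h] with x hx
    rw [hx, inner_self_eq_norm_sq_to_K]
    simp
  rw [this]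
  exact Complex.ofReal_re _

/-- On a bounded open set, a function in `H¹₀(Ω)` with vanishing gradient vanishes. -/
theorem H10_eq_zero {n : ℕ} (hn : 1 ≤ n) {Ω : Set (EuclideanSpace ℝ (Fin n))}
    (hb : Bornology.IsBounded Ω) {u : L2 Ω} (hu : (u, 0) ∈ H10 Ω) : u = 0 := by
  obtain ⟨R, hR⟩ := hb.exists_norm_le
  let i : Fin n := ⟨0, hn⟩
  have hc : IsClosed {w : L2 Ω × (Fin n → L2 Ω) | ‖w.1‖ ^ 2 ≤ 4 * R ^ 2 * ‖w.2 i‖ ^ 2} :=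
    isClosed_le (by fun_prop) (by fun_prop)
  have ht : (testPairs Ω : Set (L2 Ω × (Fin n → L2 Ω))) ⊆
      {w | ‖w.1‖ ^ 2 ≤ 4 * R ^ 2 * ‖w.2 i‖ ^ 2} := by
    rintro ⟨p, q⟩ ⟨φ, h1, h2, h3, h4, h5⟩
    have hs : Function.support (fun x => fderiv ℝ φ x (EuclideanSpace.single i 1)) ⊆ Ω := by
      intro x hx
      refine h3 (support_fderiv_subset ℝ ?_)
      intro h0
      apply hx
      simp [h0]
    simp only [mem_ofPred_eq]
    rw [norm_sq_eq_integral h4 ((subset_tsupport φ).trans h3),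
      norm_sq_eq_integral (h5 i) hs]
    exact poincare_aux i h1 h2 fun x hx =>
      (PiLp.norm_apply_le x i).trans (hR x (h3 hx))
  have := closure_minimal ht hc hu
  simpa using this

/-- The Dirichlet Laplacian of a bounded open set is injective. -/
theorem dirichletLaplacian_injective {n : ℕ} (hn : 1 ≤ n)
    {Ω : Set (EuclideanSpace ℝ (Fin n))} (hΩ : IsOpen Ω) (hb : Bornology.IsBounded Ω)
    {u : (dirichletLaplacian Ω).domain} (hu : dirichletLaplacian Ω u = 0) : u = 0 := by
  have := Submodule.mem_graph_toLinearPMap (g := dirichletGraph Ω) (dirichletGraph_single hΩ) u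
  change ((u : L2 Ω), dirichletLaplacian Ω u) ∈ dirichletGraph Ω at this
  rw [hu] at this
  obtain ⟨g, h1, h2⟩ := this
  have hg : g = 0 := by
    apply eq_zero_of_sum_inner
    simpa using dirichletGraph_test h2 _ h1
  subst hg
  exact Subtype.ext (H10_eq_zero hn hb h1)

/-! ### Real powers of the operator `A` -/

open scoped Classical in
/-- The bounded inverse `A⁻¹` of an operator `A : D(A) ⊆ H → H` which has one (and `0` if `A` has
no bounded, everywhere defined inverse). -/
def boundedInverse {H : Type*} [NormedAddCommGroup H] [NormedSpace ℂ H] (A : H →ₗ.[ℂ] H) :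
    H →L[ℂ] H :=
  if h : ∃ T : H →L[ℂ] H, (∀ u : A.domain, T (A u) = u) ∧
    ∀ f : H, ∃ u : A.domain, (u : H) = T f ∧ A u = f then h.choose else 0

/-- The negative power `A^{-s} = (A⁻¹)^s`, `0 ≤ s`, of a positive self-adjoint operator with a
bounded inverse, by the continuous functional calculus of the bounded self-adjoint operator
`A⁻¹`. -/
def negPow {H : Type*} [NormedAddCommGroup H] [InnerProductSpace ℂ H] [CompleteSpace H]
    (A : H →ₗ.[ℂ] H) (s : ℝ) : H →L[ℂ] H :=
  cfc (fun x : ℝ => x ^ s) (boundedInverse A)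

/-- The power `A^s = (A^{-s})⁻¹`, `0 ≤ s`, of a positive self-adjoint operator with a bounded
inverse; its domain `D(A^s)` is the range of `A^{-s}`. -/
def posPow {H : Type*} [NormedAddCommGroup H] [InnerProductSpace ℂ H] [CompleteSpace H]
    (A : H →ₗ.[ℂ] H) (s : ℝ) : H →ₗ.[ℂ] H :=
  ((negPow A s).toLinearMap.toPMap ⊤).inverse

/-! ### The thermoelastic plate -/

/-- The data of the thermoelastic plate system with hinged plate and Dirichlet temperature boundary
conditions,
`u_tt + γ A^τ u_tt + A² u - α A θ = 0`, `θ_t + κ A θ + β A u_t = 0`. -/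
structure PlateSystem (n : ℕ) where
  /-- the dimension is positive -/
  one_le : 1 ≤ n
  /-- the domain `Ω ⊆ ℝⁿ` -/
  Ω : Set (EuclideanSpace ℝ (Fin n))
  isOpen : IsOpen Ω
  isBounded : Bornology.IsBounded Ω
  /-- the coupling coefficients -/
  α : ℝ
  β : ℝ
  /-- the coefficient of the rotational inertia -/
  γ : ℝ
  /-- the thermal conductivity -/
  κ : ℝ
  /-- the exponent of the rotational inertia -/
  τ : ℝ
  α_pos : 0 < α
  β_pos : 0 < β
  γ_pos : 0 < γ
  κ_pos : 0 < κ
  τ_nonneg : 0 ≤ τ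
  τ_le_one : τ ≤ 1

namespace PlateSystem

variable {n : ℕ} (P : PlateSystem n)

/-- The operator `A = -Δ` on `L²(Ω)` with Dirichlet boundary conditions. -/
def A : L2 P.Ω →ₗ.[ℂ] L2 P.Ω := dirichletLaplacian P.Ω

/-- The operator `A^s` for `0 ≤ s`. -/
def Apow (s : ℝ) : L2 P.Ω →ₗ.[ℂ] L2 P.Ω := posPow P.A s

/-- The duality pairing of `(I + γ A^τ) z ∈ D(A^{-τ/2})` with `w ∈ D(A^{τ/2})`, for
`z ∈ D(A^{τ/2})`, that is `⟨w, z⟩ + γ ⟨A^{τ/2} w, A^{τ/2} z⟩`, linear in `z` and conjugate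
linear in `w`. -/
def rot (w z : (P.Apow (P.τ / 2)).domain) : ℂ :=
  ⟪(w : L2 P.Ω), (z : L2 P.Ω)⟫_ℂ +
    P.γ * ⟪P.Apow (P.τ / 2) w, P.Apow (P.τ / 2) z⟫_ℂ

/-- The phase space `ℍ = D(A) × D(A^{τ/2}) × L²(Ω)`, with elements `U = (u, v, θ)`. -/
def PhaseSpace : Type :=
  P.A.domain × (P.Apow (P.τ / 2)).domain × L2 P.Ω

instance : AddCommGroup P.PhaseSpace :=
  inferInstanceAs (AddCommGroup (P.A.domain × (P.Apow (P.τ / 2)).domain × L2 P.Ω))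

instance : Module ℂ P.PhaseSpace :=
  inferInstanceAs (Module ℂ (P.A.domain × (P.Apow (P.τ / 2)).domain × L2 P.Ω))

variable {P}

namespace PhaseSpace

/-- The displacement `u ∈ D(A)`. -/
def u : P.PhaseSpace →ₗ[ℂ] P.A.domain := LinearMap.fst ℂ _ _

/-- The velocity `v ∈ D(A^{τ/2})`. -/
def v : P.PhaseSpace →ₗ[ℂ] (P.Apow (P.τ / 2)).domain := LinearMap.fst ℂ _ _ ∘ₗ LinearMap.snd ℂ _ _

/-- The temperature `θ ∈ L²(Ω)`. -/
def θ : P.PhaseSpace →ₗ[ℂ] L2 P.Ω := LinearMap.snd ℂ _ _ ∘ₗ LinearMap.snd ℂ _ _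

theorem ext' {U V : P.PhaseSpace} (h1 : u U = u V) (h2 : v U = v V) (h3 : θ U = θ V) : U = V :=
  Prod.ext h1 (Prod.ext h2 h3)

end PhaseSpace

open PhaseSpace

variable (P)

/-- The inner product of the phase space,
`β ⟨A u₁, A u₂⟩ + β ⟨(I + γ A^τ) v₁, v₂⟩ + α ⟨θ₁, θ₂⟩`. -/
@[reducible] def phaseCore : InnerProductSpace.Core ℂ P.PhaseSpace where
  inner U V := P.β * ⟪P.A (u U), P.A (u V)⟫_ℂ + P.β * P.rot (v U) (v V) + P.α * ⟪θ U, θ V⟫_ℂ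
  conj_inner_symm U V := by simp [rot]
  re_inner_nonneg U := by
    have hα := P.α_pos; have hβ := P.β_pos; have hγ := P.γ_pos
    simp only [rot, inner_self_eq_norm_sq_to_K, ← Complex.ofReal_pow, ← Complex.ofReal_mul,
      ← Complex.ofReal_add, RCLike.re_to_complex, Complex.ofReal_re, Complex.coe_algebraMap]
    positivity
  add_left U V W := by
    simp only [rot, map_add, LinearPMap.map_add, Submodule.coe_add, inner_add_left]; ring
  smul_left U V c := by
    simp only [rot, map_smul, LinearPMap.map_smul, Submodule.coe_smul, inner_smul_left]; ring
  definite U h := by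
    have hα := P.α_pos; have hβ := P.β_pos; have hγ := P.γ_pos
    simp only [rot, inner_self_eq_norm_sq_to_K, Complex.coe_algebraMap, ← Complex.ofReal_pow,
      ← Complex.ofReal_mul, ← Complex.ofReal_add, Complex.ofReal_eq_zero] at h
    have a1 : 0 ≤ P.β * ‖P.A (u U)‖ ^ 2 := by positivity
    have a2 : 0 ≤ P.β * ‖(v U : L2 P.Ω)‖ ^ 2 := by positivity
    have a3 : 0 ≤ P.β * (P.γ * ‖P.Apow (P.τ / 2) (v U)‖ ^ 2) := by positivity
    have a4 : 0 ≤ P.α * ‖θ U‖ ^ 2 := by positivity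
    have b1 : P.β * ‖P.A (u U)‖ ^ 2 = 0 := by linarith
    have b2 : P.β * ‖(v U : L2 P.Ω)‖ ^ 2 = 0 := by linarith
    have b4 : P.α * ‖θ U‖ ^ 2 = 0 := by linarith
    have c1 : P.A (u U) = 0 := by simpa [hβ.ne'] using b1
    have c2 : (v U : L2 P.Ω) = 0 := by simpa [hβ.ne'] using b2
    have c4 : θ U = 0 := by simpa [hα.ne'] using b4
    refine ext' ?_ (Subtype.ext ?_) ?_
    · rw [map_zero]
      exact dirichletLaplacian_injective P.one_le P.isOpen P.isBounded c1
    · rw [map_zero]; exact c2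
    · rw [map_zero]; exact c4

instance : NormedAddCommGroup P.PhaseSpace :=
  InnerProductSpace.Core.toNormedAddCommGroup (cd := P.phaseCore)

instance : InnerProductSpace ℂ P.PhaseSpace :=
  InnerProductSpace.ofCore P.phaseCore.toCore

/-- The condition defining the domain of `𝔹`:
`v ∈ D(A)`, `-A u + α θ ∈ D(A^{1 - τ/2})` and `-κ θ - β v ∈ D(A)`. -/
structure InDomain (U : P.PhaseSpace) : Prop where
  v_mem : (v U : L2 P.Ω) ∈ P.A.domain
  w_mem : -P.A (u U) + (P.α : ℂ) • θ U ∈ (P.Apow (1 - P.τ / 2)).domain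
  q_mem : -(P.κ : ℂ) • θ U - (P.β : ℂ) • (v U : L2 P.Ω) ∈ P.A.domain

/-- The graph of `𝔹`: the pairs `(U, F)` with `U = (u, v, θ)` in the domain of `𝔹` and
`F = (v, (I + γ A^τ)⁻¹ (-A² u + α A θ), -κ A θ - β A v)`. Here `-A² u + α A θ` is the element
`A (-A u + α θ)` of the dual space `D(A^{-τ/2})` of `D(A^{τ/2})`, whose pairing
with `z ∈ D(A^{τ/2})` is `⟨A^{τ/2} z, A^{1 - τ/2} (-A u + α θ)⟩` (linear in `u`, `θ`, conjugate
linear in `z`). -/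
def Bgraph : Submodule ℂ (P.PhaseSpace × P.PhaseSpace) where
  carrier := {p | ∃ h : P.InDomain p.1,
    u p.2 = ⟨v p.1, h.v_mem⟩ ∧
    (∀ z : (P.Apow (P.τ / 2)).domain,
      P.rot z (v p.2) = ⟪P.Apow (P.τ / 2) z, P.Apow (1 - P.τ / 2) ⟨_, h.w_mem⟩⟫_ℂ) ∧
    θ p.2 = P.A ⟨_, h.q_mem⟩}
  add_mem' := by
    rintro ⟨U, F⟩ ⟨U', F'⟩ ⟨h, e1, e2, e3⟩ ⟨h', e1', e2', e3'⟩
    have w : -P.A (u (U + U')) + (P.α : ℂ) • θ (U + U') =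
        (-P.A (u U) + (P.α : ℂ) • θ U) + (-P.A (u U') + (P.α : ℂ) • θ U') := by
      simp only [map_add, LinearPMap.map_add, smul_add]; abel
    have q : -(P.κ : ℂ) • θ (U + U') - (P.β : ℂ) • (v (U + U') : L2 P.Ω) =
        (-(P.κ : ℂ) • θ U - (P.β : ℂ) • (v U : L2 P.Ω)) +
        (-(P.κ : ℂ) • θ U' - (P.β : ℂ) • (v U' : L2 P.Ω)) := by
      simp only [map_add, Submodule.coe_add, smul_add]; abel
    have hd : P.InDomain (U + U') :=
      ⟨by rw [map_add]; exact add_mem h.v_mem h'.v_mem, by rw [w]; exact add_mem h.w_mem h'.w_mem,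
        by rw [q]; exact add_mem h.q_mem h'.q_mem⟩
    refine ⟨hd, ?_, fun z => ?_, ?_⟩
    · apply Subtype.ext
      have f1 := congrArg Subtype.val e1
      have f2 := congrArg Subtype.val e1'
      simp only [Prod.mk_add_mk, map_add, Submodule.coe_add] at f1 f2 ⊢
      rw [f1, f2]
    · have k1 := e2 z
      have k2 := e2' z
      have : P.Apow (1 - P.τ / 2) ⟨_, hd.w_mem⟩ =
          P.Apow (1 - P.τ / 2) ⟨_, h.w_mem⟩ + P.Apow (1 - P.τ / 2) ⟨_, h'.w_mem⟩ := by
        rw [← LinearPMap.map_add]; congr 1; exact Subtype.ext w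
      refine Eq.trans ?_ (congrArg _ this).symm
      rw [inner_add_right, ← k1, ← k2]
      simp only [rot, Prod.mk_add_mk, map_add, LinearPMap.map_add, Submodule.coe_add,
        inner_add_right]
      ring
    · have : P.A ⟨_, hd.q_mem⟩ = P.A ⟨_, h.q_mem⟩ + P.A ⟨_, h'.q_mem⟩ := by
        rw [← LinearPMap.map_add]; congr 1; exact Subtype.ext q
      refine Eq.trans ?_ this.symm
      rw [← e3, ← e3']
      simp
  zero_mem' := by
    have w : -P.A (u (0 : P.PhaseSpace)) + (P.α : ℂ) • θ (0 : P.PhaseSpace) = 0 := by simp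
    have q : -(P.κ : ℂ) • θ (0 : P.PhaseSpace) -
        (P.β : ℂ) • (v (0 : P.PhaseSpace) : L2 P.Ω) = 0 := by
      simp
    have hd : P.InDomain (0 : P.PhaseSpace) :=
      ⟨by simp, by rw [w]; exact zero_mem _, by rw [q]; exact zero_mem _⟩
    refine ⟨hd, ?_, fun z => ?_, ?_⟩
    · apply Subtype.ext; simp
    · have : P.Apow (1 - P.τ / 2) ⟨_, hd.w_mem⟩ = 0 := by
        rw [← LinearPMap.map_zero (P.Apow (1 - P.τ / 2))]; congr 1; exact Subtype.ext w
      refine Eq.trans ?_ (congrArg _ this).symm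
      simp [rot]
    · have : P.A ⟨_, hd.q_mem⟩ = 0 := by
        rw [← LinearPMap.map_zero P.A]; congr 1; exact Subtype.ext q
      refine Eq.trans ?_ this.symm
      simp
  smul_mem' := by
    rintro c ⟨U, F⟩ ⟨h, e1, e2, e3⟩
    have w : -P.A (u (c • U)) + (P.α : ℂ) • θ (c • U) = c • (-P.A (u U) + (P.α : ℂ) • θ U) := by
      simp only [map_smul, LinearPMap.map_smul, smul_add, smul_neg, smul_comm c]
    have q : -(P.κ : ℂ) • θ (c • U) - (P.β : ℂ) • (v (c • U) : L2 P.Ω) =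
        c • (-(P.κ : ℂ) • θ U - (P.β : ℂ) • (v U : L2 P.Ω)) := by
      simp only [map_smul, Submodule.coe_smul, smul_sub, smul_comm c]
    have hd : P.InDomain (c • U) :=
      ⟨by rw [map_smul]; exact Submodule.smul_mem _ c h.v_mem,
        by rw [w]; exact Submodule.smul_mem _ c h.w_mem,
        by rw [q]; exact Submodule.smul_mem _ c h.q_mem⟩
    refine ⟨hd, ?_, fun z => ?_, ?_⟩
    · apply Subtype.ext
      have f1 := congrArg Subtype.val e1
      simp only [Prod.smul_mk, map_smul, Submodule.coe_smul] at f1 ⊢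
      rw [f1]
    · have k1 := e2 z
      have : P.Apow (1 - P.τ / 2) ⟨_, hd.w_mem⟩ = c • P.Apow (1 - P.τ / 2) ⟨_, h.w_mem⟩ := by
        rw [← LinearPMap.map_smul]; congr 1; exact Subtype.ext w
      refine Eq.trans ?_ (congrArg _ this).symm
      rw [inner_smul_right, ← k1]
      simp only [rot, Prod.smul_mk, map_smul, LinearPMap.map_smul, Submodule.coe_smul,
        inner_smul_right]
      ring
    · have : P.A ⟨_, hd.q_mem⟩ = c • P.A ⟨_, h.q_mem⟩ := by
        rw [← LinearPMap.map_smul]; congr 1; exact Subtype.ext q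
      refine Eq.trans ?_ this.symm
      rw [← e3]
      simp

/-- The operator `𝔹` on the phase space. -/
def B : P.PhaseSpace →ₗ.[ℂ] P.PhaseSpace := P.Bgraph.toLinearPMap

theorem B_graph : P.B.graph = P.Bgraph := by
  refine Submodule.toLinearPMap_graph_eq _ ?_
  rintro ⟨U, F⟩ ⟨h, e1, e2, e3⟩ h0
  simp only at h0 h e1 e2 e3 ⊢
  subst h0
  have hγ := P.γ_pos
  refine ext' ?_ ?_ ?_
  · refine e1.trans ?_; apply Subtype.ext; simp
  · have h1 := e2 (v F)
    have : P.Apow (1 - P.τ / 2) ⟨_, h.w_mem⟩ = 0 := by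
      rw [← LinearPMap.map_zero (P.Apow (1 - P.τ / 2))]; congr 1; apply Subtype.ext; simp
    have h2 := h1.trans (congrArg _ this)
    simp only [rot, inner_zero_right, inner_self_eq_norm_sq_to_K, Complex.coe_algebraMap,
      ← Complex.ofReal_pow, ← Complex.ofReal_mul, ← Complex.ofReal_add,
      Complex.ofReal_eq_zero] at h2
    have a3 : 0 ≤ P.γ * ‖P.Apow (P.τ / 2) (v F)‖ ^ 2 := by positivity
    have b2 : ‖(v F : L2 P.Ω)‖ ^ 2 = 0 := le_antisymm (by linarith) (by positivity)
    rw [map_zero]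
    exact Subtype.ext (by simpa using b2)
  · refine e3.trans ?_
    have : P.A ⟨_, h.q_mem⟩ = 0 := by
      rw [← LinearPMap.map_zero P.A]; congr 1; apply Subtype.ext; simp
    exact this.trans (map_zero _).symm

end PlateSystem

/-! ### Semigroups and solutions of the abstract Cauchy problem -/

section Cauchy

variable {X : Type*}

/-- A `C₀`-semigroup of contractions on `X`. -/
structure IsContractionSemigroup [NormedAddCommGroup X] [NormedSpace ℂ X]
    (S : ℝ≥0 → X →L[ℂ] X) : Prop where
  map_zero : S 0 = ContinuousLinearMap.id ℂ X
  map_add : ∀ s t, S (s + t) = (S s).comp (S t)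
  continuous : ∀ x, Continuous fun t => S t x
  norm_le : ∀ t, ‖S t‖ ≤ 1

/-- `B` is the infinitesimal generator of `S`: a vector `x` is in the domain of `B` and
`B x = y` if and only if `(S(t) x - x) / t → y` as `t → 0+`. -/
def IsGenerator [NormedAddCommGroup X] [NormedSpace ℂ X] (B : X →ₗ.[ℂ] X)
    (S : ℝ≥0 → X →L[ℂ] X) : Prop :=
  ∀ x y, (x, y) ∈ B.graph ↔ Tendsto (fun t : ℝ≥0 => (t : ℝ)⁻¹ • (S t x - x)) (𝓝[>] 0) (𝓝 y)

/-- `U ∈ C([0,∞), X)` is a weak solution of `dU/dt = B U`, `U(0) = U₀`: for all `V ∈ D(B*)`, with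
`W = B* V`, one has `d/dt ⟨U(t), V⟩ = ⟨U(t), W⟩` for `t ≥ 0`. Only the values `U(t)` with `t ≥ 0`
matter. -/
structure IsWeakSolution [NormedAddCommGroup X] [InnerProductSpace ℂ X] (B : X →ₗ.[ℂ] X) (U₀ : X)
    (U : ℝ → X) : Prop where
  continuousOn : ContinuousOn U (Ici 0)
  initial : U 0 = U₀
  weak : ∀ V W : X, (∀ x : B.domain, ⟪V, B x⟫_ℂ = ⟪W, (x : X)⟫_ℂ) →
    ∀ t ∈ Ici (0 : ℝ), HasDerivWithinAt (fun s => ⟪V, U s⟫_ℂ) ⟪W, U t⟫_ℂ (Ici 0) t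

/-- The powers of an operator with a domain: `D(B⁰) = X` and `B⁰ x = x`;
`D(B^{j+1}) = {x ∈ D(B) : B x ∈ D(B^j)}` and `B^{j+1} x = B^j (B x)`. -/
def iter [AddCommGroup X] [Module ℂ X] (B : X →ₗ.[ℂ] X) : ℕ → (X →ₗ.[ℂ] X)
  | 0 => LinearMap.id.toPMap ⊤
  | j + 1 => (iter B j).comp
      (B.domRestrict (((iter B j).domain.comap B.toFun).map B.domain.subtype)) (by
        rintro ⟨x, hx, hx'⟩
        obtain ⟨y, hy, rfl⟩ := hx
        exact hy)

/-- `U ∈ C^m([0,∞), D(Q))`, where `D(Q)` carries the graph norm of the operator `Q`; the space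
`D(Q)` is identified with the graph of `Q`. -/
def IsCkInDomain [NormedAddCommGroup X] [NormedSpace ℂ X] (m : ℕ) (Q : X →ₗ.[ℂ] X)
    (U : ℝ → X) : Prop :=
  ∃ W : ℝ → Q.graph, ContDiffOn ℝ m W (Ici 0) ∧ ∀ t ∈ Ici (0 : ℝ), (W t : X × X).1 = U t

end Cauchy

end ThermoPlate

end

noncomputable section

namespace ThermoPlate

/-! ### Bounded dissipative operators -/

section Dissipative

variable {X : Type*} [NormedAddCommGroup X] [InnerProductSpace ℂ X]

/-! Everything goes through `K = 𝔹⁻¹`, which is bounded and everywhere defined, so the unbounded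
operator is met only through its graph `{(K y, y)}`. Writing `(u, v, θ)` in the coordinates `(A u,
A^{τ/2} v, θ)` identifies the phase space with `L² × L² × L²` up to equivalent norms, which gives
completeness. There the equation `𝔹 U = F` is solved explicitly by means of `A⁻¹ = A^{-τ/2}
A^{-(1-τ/2)}` (`mem_B_graph_iff_eq_Binv`). In `Re ⟨K F, F⟩` the mechanical terms and the rotational
inertia cancel; the heat equation leaves a nonpositive multiple of a quadratic form of `A⁻¹`
(`isDissipative_Binv`).

An injective bounded dissipative `K` on a Hilbert space has dense range, because `ker K* ⊆ ker K`;
so `𝔹` is densely defined without further work. The operators `(K - ε)⁻¹` are bounded, dissipative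
and commute. Their exponentials are contractions and converge strongly as `ε → 0`, uniformly on
bounded time intervals (`IsDissipative.exists_semigroup`). The limit satisfies `S(t) K x = K x + ∫₀ᵗ
S(s) x ds`; this identity and `S(t) K = K S(t)` yield the generator, the weak equation and the
regularity. Uniqueness is an energy estimate for the time integral of the difference of two
solutions (`IsWeakSolution.eqOn`).

The operator `A⁻¹` itself comes from the Riesz representation theorem and Poincaré's inequality, and
its powers from the functional calculus. -/

/-- A bounded operator `K` is dissipative if `Re ⟨K x, x⟩ ≤ 0` for all `x`. -/
def IsDissipative (K : X →L[ℂ] X) : Prop := ∀ x, (⟪K x, x⟫_ℂ).re ≤ 0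

theorem re_inner_symm (x y : X) : (⟪x, y⟫_ℂ).re = (⟪y, x⟫_ℂ).re := inner_re_symm (𝕜 := ℂ) x y

theorem re_inner_self (x : X) : (⟪x, x⟫_ℂ).re = ‖x‖ ^ 2 := inner_self_eq_norm_sq (𝕜 := ℂ) x

namespace IsDissipative

variable {K : X →L[ℂ] X}

/-- The term `-ε` makes the real part of the form at most `-ε ‖x‖²`. This coercivity gives both the
invertibility of `K - ε` and the bound `1/ε` for its inverse. -/
theorem le_norm_sub (hK : IsDissipative K) (ε : ℝ) (x : X) :
    ε * ‖x‖ ^ 2 ≤ ‖⟪(K - (ε : ℂ) • (1 : X →L[ℂ] X)) x, x⟫_ℂ‖ := by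
  refine le_trans ?_ (Complex.abs_re_le_norm _)
  refine le_trans ?_ (neg_le_abs _)
  have := hK x
  simp only [sub_apply, smul_apply,
    one_apply_eq_self, inner_sub_left, inner_smul_left, Complex.conj_ofReal,
    Complex.sub_re, Complex.re_ofReal_mul, re_inner_self]
  linarith

/-- An element in the kernel of the adjoint of a dissipative operator is in its kernel. -/
theorem apply_eq_zero (hK : IsDissipative K) {y : X} (h : ∀ x, ⟪K x, y⟫_ℂ = 0) : K y = 0 := by
  -- Dissipativity at `y + t K y`: all pairings with `y` vanish, so for small `t > 0` the linear
  -- term would win unless `K y = 0`.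
  have key : ∀ t : ℝ, t * ‖K y‖ ^ 2 + t ^ 2 * (⟪K (K y), K y⟫_ℂ).re ≤ 0 := by
    intro t
    have h1 := hK (y + (t : ℂ) • K y)
    simp only [map_add, map_smul, inner_add_left, inner_add_right, inner_smul_left,
      inner_smul_right, Complex.conj_ofReal, h, Complex.add_re, Complex.re_ofReal_mul,
      re_inner_self, mul_zero, zero_add, add_zero] at h1
    linarith
  have hc := hK (K y)
  set c := (⟪K (K y), K y⟫_ℂ).re
  by_contra hne
  have hp : 0 < ‖K y‖ ^ 2 := by positivity
  -- Since `c ≤ 0`, this `t` is positive and `t a + t² c = t² (2 - c) > 0`; the `1` in `1 - c`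
  -- covers the case `c = 0`.
  have h2 := key (‖K y‖ ^ 2 / (2 * (1 - c)))
  have h3 : 0 < 2 * (1 - c) := by linarith
  set a := ‖K y‖ ^ 2
  set t := a / (2 * (1 - c)) with ht
  have htp : 0 < t := div_pos hp h3
  have h4 : t * (2 * (1 - c)) = a := div_mul_cancel₀ _ h3.ne'
  nlinarith

/-- The orthogonal complement of the range is the kernel of the adjoint, which `apply_eq_zero` puts
inside `ker K = 0`. -/
theorem denseRange [CompleteSpace X] (hK : IsDissipative K) (hinj : ∀ x, K x = 0 → x = 0) :
    DenseRange K := by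
  have : K.range.topologicalClosure = ⊤ := by
    rw [Submodule.topologicalClosure_eq_top_iff, Submodule.eq_bot_iff]
    intro y hy
    refine hinj y (hK.apply_eq_zero fun x => ?_)
    exact hy (K x) ⟨x, rfl⟩
  rw [denseRange_iff_closure_range]
  exact congrArg (fun S : Submodule ℂ X => (S : Set X)) this

variable [CompleteSpace X]

theorem isUnit_sub (hK : IsDissipative K) {ε : ℝ} (hε : 0 < ε) :
    IsUnit (K - (ε : ℂ) • (1 : X →L[ℂ] X)) :=
  ContinuousLinearMap.isUnit_of_forall_le_norm_inner_map _ (c := ⟨ε, hε.le⟩) hε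
    fun x => (mul_comm _ _).trans_le (hK.le_norm_sub ε x)

/-- For a bounded dissipative operator `D` and `t ≥ 0`, `exp (t D)` is a contraction. -/
theorem norm_exp_apply_le {D : X →L[ℂ] X} (hD : IsDissipative D) {t : ℝ} (ht : 0 ≤ t) (x : X) :
    ‖NormedSpace.exp (t • D) x‖ ≤ ‖x‖ := by
  have hd : ∀ s : ℝ, HasDerivAt (fun s : ℝ => NormedSpace.exp (s • D) x)
      (D (NormedSpace.exp (s • D) x)) s := fun s => by
    have := (hasDerivAt_exp_smul_const' (𝕂 := ℝ) D s)
    exact ((ContinuousLinearMap.apply ℂ X x).restrictScalars ℝ).hasFDerivAt.comp_hasDerivAt s this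
  have hd2 : ∀ s : ℝ, HasDerivAt (fun s : ℝ => ‖NormedSpace.exp (s • D) x‖ ^ 2)
      (2 * (⟪D (NormedSpace.exp (s • D) x), NormedSpace.exp (s • D) x⟫_ℂ).re) s := fun s => by
    have h1 := (hd s).inner ℂ (hd s)
    have h2 := Complex.reCLM.hasFDerivAt.comp_hasDerivAt s h1
    simp only [Function.comp_def, Complex.reCLM_apply, Complex.add_re, re_inner_self] at h2
    rw [re_inner_symm (NormedSpace.exp (s • D) x), ← two_mul] at h2
    exact h2
  have ha : Antitone (fun s : ℝ => ‖NormedSpace.exp (s • D) x‖ ^ 2) :=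
    antitone_of_deriv_nonpos (fun s => (hd2 s).differentiableAt) fun s => by
      rw [(hd2 s).deriv]; have := hD (NormedSpace.exp (s • D) x); linarith
  have := ha ht
  simp only [zero_smul, NormedSpace.exp_zero, one_apply_eq_self] at this
  exact le_of_sq_le_sq this (norm_nonneg _)

end IsDissipative

end Dissipative

/-! ### Yosida approximations and their exponentials -/

section Yosida

variable {X : Type*} [NormedAddCommGroup X] [InnerProductSpace ℂ X]

/-- The Yosida approximation `(K - ε)⁻¹ = B (1 - ε B)⁻¹` of the operator `B = K⁻¹`. -/
def yosida (K : X →L[ℂ] X) (ε : ℝ) : X →L[ℂ] X := Ring.inverse (K - (ε : ℂ) • (1 : X →L[ℂ] X))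

theorem yosida_commute (K : X →L[ℂ] X) (ε δ : ℝ) : Commute (yosida K ε) (yosida K δ) := by
  apply Commute.ringInverse_ringInverse
  have h1 : ∀ (c : ℂ) (T : X →L[ℂ] X), Commute (c • (1 : X →L[ℂ] X)) T := fun c T =>
    (Commute.one_left T).smul_left c
  exact ((Commute.refl K).sub_left (h1 _ _)).sub_right (((h1 _ _).symm))

namespace IsDissipative

variable [CompleteSpace X] {K : X →L[ℂ] X} {ε : ℝ}

theorem sub_yosida_apply (hK : IsDissipative K) (hε : 0 < ε) (x : X) :
    K (yosida K ε x) - (ε : ℂ) • yosida K ε x = x := by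
  have := congrArg (fun T : X →L[ℂ] X => T x) (Ring.mul_inverse_cancel _ (hK.isUnit_sub hε))
  simpa [yosida] using this

theorem yosida_apply (hK : IsDissipative K) (hε : 0 < ε) (x : X) :
    yosida K ε (K x) = x + (ε : ℂ) • yosida K ε x := by
  have := congrArg (fun T : X →L[ℂ] X => T x) (Ring.inverse_mul_cancel _ (hK.isUnit_sub hε))
  rw [← sub_eq_iff_eq_add]
  simpa [yosida] using this

theorem commute_yosida (hK : IsDissipative K) (hε : 0 < ε) : Commute K (yosida K ε) := by
  ext x
  refine Eq.trans ?_ (hK.yosida_apply hε x).symm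
  rw [← sub_eq_iff_eq_add]
  exact hK.sub_yosida_apply hε x

/-- With `z = (K - ε)⁻¹ x` one has `x = K z - ε z`, hence `Re ⟨x, z⟩ = Re ⟨K z, z⟩ - ε ‖z‖²`. -/
theorem isDissipative_yosida (hK : IsDissipative K) (hε : 0 < ε) : IsDissipative (yosida K ε) := by
  intro x
  have h := hK (yosida K ε x)
  have h2 := hK.sub_yosida_apply hε x
  rw [sub_eq_iff_eq_add] at h2
  rw [h2, inner_add_left, inner_smul_left, Complex.conj_ofReal, Complex.add_re,
    Complex.re_ofReal_mul, re_inner_self] at h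
  rw [re_inner_symm]
  have : 0 ≤ ε * ‖yosida K ε x‖ ^ 2 := by positivity
  linarith

/-- Coercivity at `z = (K - ε)⁻¹ x` gives `ε ‖z‖² ≤ |⟨x, z⟩| ≤ ‖x‖ ‖z‖`, and a factor `‖z‖` cancels.
-/
theorem norm_smul_yosida_le (hK : IsDissipative K) (hε : 0 < ε) (x : X) :
    ‖(ε : ℂ) • yosida K ε x‖ ≤ ‖x‖ := by
  have h := hK.le_norm_sub ε (yosida K ε x)
  have h2 := (norm_inner_le_norm (𝕜 := ℂ) ((K - (ε : ℂ) • (1 : X →L[ℂ] X))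
    (yosida K ε x)) (yosida K ε x))
  have h3 : (K - (ε : ℂ) • (1 : X →L[ℂ] X)) (yosida K ε x) = x := by
    simpa using hK.sub_yosida_apply hε x
  rw [h3] at h h2
  rw [norm_smul, Complex.norm_real, Real.norm_of_nonneg hε.le]
  by_cases h0 : ‖yosida K ε x‖ = 0
  · rw [h0]; simp
  · have hp : 0 < ‖yosida K ε x‖ := lt_of_le_of_ne (norm_nonneg _) (Ne.symm h0)
    refine le_of_mul_le_mul_right ?_ hp
    nlinarith

/-- The resolvents `(1 - ε B)⁻¹` of `B = K⁻¹` converge strongly to the identity. -/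
theorem tendsto_yosida_apply (hK : IsDissipative K) (hinj : ∀ x, K x = 0 → x = 0) (x : X) :
    Tendsto (fun ε => yosida K ε (K x)) (𝓝[>] 0) (𝓝 x) := by
  have key : Tendsto (fun ε : ℝ => (ε : ℂ) • yosida K ε x) (𝓝[>] 0) (𝓝 0) := by
    rw [Metric.tendsto_nhds]
    intro r hr
    -- The operators `ε (K - ε)⁻¹` are contractions, so it suffices to treat vectors `K z`, which
    -- are dense; on them the value is `ε (z + ε (K - ε)⁻¹ z)`, of norm at most `2 ε ‖z‖`.
    obtain ⟨z, hz⟩ := (hK.denseRange hinj).exists_dist_lt x (half_pos hr)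
    have h1 : Tendsto (fun ε : ℝ => ε * (2 * ‖z‖)) (𝓝[>] 0) (𝓝 0) := by
      have : Tendsto (fun ε : ℝ => ε * (2 * ‖z‖)) (𝓝 0) (𝓝 (0 * (2 * ‖z‖))) :=
        tendsto_id.mul_const _
      rw [zero_mul] at this
      exact this.mono_left nhdsWithin_le_nhds
    filter_upwards [h1.eventually_lt_const (half_pos hr), self_mem_nhdsWithin] with ε h2 h3
    have hε : 0 < ε := h3
    rw [dist_zero_right]
    have e : (ε : ℂ) • yosida K ε x = (ε : ℂ) • yosida K ε (x - K z) +
        (ε : ℂ) • (z + (ε : ℂ) • yosida K ε z) := by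
      rw [← hK.yosida_apply hε z, ← smul_add, ← map_add, sub_add_cancel]
    have n1 := hK.norm_smul_yosida_le hε (x - K z)
    have n2 : ‖(ε : ℂ) • (z + (ε : ℂ) • yosida K ε z)‖ ≤ ε * (2 * ‖z‖) := by
      rw [norm_smul, Complex.norm_real, Real.norm_of_nonneg hε.le]
      have := norm_add_le z ((ε : ℂ) • yosida K ε z)
      have := hK.norm_smul_yosida_le hε z
      gcongr
      linarith
    rw [dist_eq_norm] at hz
    rw [e]
    have := norm_add_le ((ε : ℂ) • yosida K ε (x - K z))
      ((ε : ℂ) • (z + (ε : ℂ) • yosida K ε z))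
    linarith
  have h2 : Tendsto (fun ε : ℝ => x + (ε : ℂ) • yosida K ε x) (𝓝[>] 0) (𝓝 x) := by
    simpa using key.const_add x
  refine h2.congr' ?_
  filter_upwards [self_mem_nhdsWithin] with ε h3
  exact (hK.yosida_apply h3 x).symm

end IsDissipative

theorem hasDerivAt_exp_smul_apply [CompleteSpace X] (D : X →L[ℂ] X) (x : X) (s : ℝ) :
    HasDerivAt (fun s : ℝ => NormedSpace.exp (s • D) x) (NormedSpace.exp (s • D) (D x)) s :=
  ((ContinuousLinearMap.apply ℂ X x).restrictScalars ℝ).hasFDerivAt.comp_hasDerivAt s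
    (hasDerivAt_exp_smul_const (𝕂 := ℝ) D s)

/-- The distance of the exponentials of two commuting dissipative operators. -/
theorem IsDissipative.norm_exp_sub_exp_le [CompleteSpace X] {D D' : X →L[ℂ] X}
    (hD : IsDissipative D) (hD' : IsDissipative D') (hc : Commute D D') {t : ℝ} (ht : 0 ≤ t)
    (x : X) :
    ‖NormedSpace.exp (t • D) x - NormedSpace.exp (t • D') x‖ ≤ ‖D x - D' x‖ * t := by
  -- The path `s ↦ e^{(t-s)D'} e^{sD} x` joins `e^{tD'} x` to `e^{tD} x`; by commutation its
  -- velocity is two contractions applied to `D x - D' x`.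
  have hd : ∀ s ∈ Icc (0 : ℝ) t, HasDerivWithinAt
      (fun s : ℝ => NormedSpace.exp ((t - s) • D') (NormedSpace.exp (s • D) x))
      (NormedSpace.exp ((t - s) • D') (NormedSpace.exp (s • D) (D x - D' x))) (Icc 0 t) s := by
    intro s _
    have h1 : HasDerivAt (fun s : ℝ => NormedSpace.exp ((t - s) • D'))
        ((-1 : ℝ) • (NormedSpace.exp ((t - s) • D') * D')) s :=
      HasDerivAt.scomp s (hasDerivAt_exp_smul_const (𝕂 := ℝ) D' (t - s))
        ((hasDerivAt_id s).const_sub t)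
    have h2 : HasDerivAt (fun s : ℝ => NormedSpace.exp (s • D))
        (NormedSpace.exp (s • D) * D) s := hasDerivAt_exp_smul_const (𝕂 := ℝ) D s
    have h3 := h1.mul h2
    have h4 := ((ContinuousLinearMap.apply ℂ X x).restrictScalars ℝ).hasFDerivAt.comp_hasDerivAt s h3
    have hcm : Commute D' (NormedSpace.exp (s • D)) :=
      Commute.exp_right (((hc.symm).smul_right s))
    refine HasDerivAt.hasDerivWithinAt (h4.congr_deriv ?_)
    have this : ∀ x, D' (NormedSpace.exp (s • D) x) = NormedSpace.exp (s • D) (D' x) :=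
      fun x => congrArg (fun T : X →L[ℂ] X => T x) hcm.eq
    simp [this, ← sub_eq_neg_add]
  have := (convex_Icc (0 : ℝ) t).norm_image_sub_le_of_norm_hasDerivWithin_le hd
    (C := ‖D x - D' x‖) (fun s hs =>
      (hD'.norm_exp_apply_le (sub_nonneg.2 hs.2) _).trans (hD.norm_exp_apply_le hs.1 _))
    (left_mem_Icc.2 ht) (right_mem_Icc.2 ht)
  simpa [abs_of_nonneg ht] using this

end Yosida
end ThermoPlate

namespace ThermoPlate

/-! ### Construction of the semigroup as a strong limit -/

section Generation

variable {X : Type*} [NormedAddCommGroup X] [InnerProductSpace ℂ X] [CompleteSpace X]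

/-- The semigroups generated by the Yosida approximations of `K⁻¹`. -/
def yosidaSemigroup (K : X →L[ℂ] X) (n : ℕ) (t : ℝ) : X →L[ℂ] X :=
  NormedSpace.exp (t • yosida K (1 / ((n : ℝ) + 1)))

/-- The equation in integrated form contains no time derivative and therefore survives the strong
limit. -/
theorem yosidaSemigroup_apply_eq_add_integral (K : X →L[ℂ] X) (n : ℕ) (t : ℝ) (x : X) :
    yosidaSemigroup K n t (K x) = K x +
      ∫ s in (0 : ℝ)..t, yosidaSemigroup K n s (yosida K (1 / ((n : ℝ) + 1)) (K x)) := by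
  have hd := fun s (_ : s ∈ uIcc 0 t) => hasDerivAt_exp_smul_apply (yosida K (1 / ((n : ℝ) + 1))) (K x) s
  have hc : Continuous fun s : ℝ =>
      NormedSpace.exp (s • yosida K (1 / ((n : ℝ) + 1))) (yosida K (1 / ((n : ℝ) + 1)) (K x)) :=
    continuous_iff_continuousAt.2 fun s => (hasDerivAt_exp_smul_apply _ _ s).continuousAt
  have := intervalIntegral.integral_eq_sub_of_hasDerivAt hd (hc.intervalIntegrable 0 t)
  unfold yosidaSemigroup
  rw [this]; simp

namespace IsDissipative

variable {K : X →L[ℂ] X}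

theorem norm_yosidaSemigroup_le (hK : IsDissipative K) (n : ℕ) {t : ℝ} (ht : 0 ≤ t) (x : X) :
    ‖yosidaSemigroup K n t x‖ ≤ ‖x‖ :=
  (hK.isDissipative_yosida Nat.one_div_pos_of_nat).norm_exp_apply_le ht x

theorem tendsto_yosida_seq (hK : IsDissipative K) (hinj : ∀ x, K x = 0 → x = 0) (x : X) :
    Tendsto (fun n : ℕ => yosida K (1 / ((n : ℝ) + 1)) (K x)) atTop (𝓝 x) :=
  (hK.tendsto_yosida_apply hinj x).comp
    (tendsto_nhdsWithin_iff.2 ⟨tendsto_one_div_add_atTop_nhds_zero_nat,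
      .of_forall fun _ => mem_Ioi.2 Nat.one_div_pos_of_nat⟩)

theorem uniformCauchySeqOn_yosidaSemigroup (hK : IsDissipative K)
    (hinj : ∀ x, K x = 0 → x = 0) (x : X) (T : ℝ) :
    UniformCauchySeqOn (fun n t => yosidaSemigroup K n t x) atTop (Icc 0 T) := by
  rw [Metric.uniformCauchySeqOn_iff]
  intro r hr
  -- For `x` within `r/4` of `K y`, the two contractions cost less than `r/2` together. On `K y` the
  -- difference is at most `T` times that of the Yosida approximations, which converge to `y`.
  obtain ⟨y, hy⟩ := (hK.denseRange hinj).exists_dist_lt x (show 0 < r / 4 by positivity)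
  have hs := (hK.tendsto_yosida_seq hinj y).cauchySeq
  obtain ⟨N, hN⟩ := Metric.cauchySeq_iff.1 hs (r / (2 * (|T| + 1))) (by positivity)
  refine ⟨N, fun m hm n hn t ht => ?_⟩
  have h1 := hN m hm n hn
  rw [dist_eq_norm] at h1 hy ⊢
  have h2 := (hK.isDissipative_yosida (ε := 1 / ((m : ℝ) + 1)) Nat.one_div_pos_of_nat
    ).norm_exp_sub_exp_le (hK.isDissipative_yosida (ε := 1 / ((n : ℝ) + 1)) Nat.one_div_pos_of_nat)
    (yosida_commute K _ _) ht.1 (K y)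
  have h3 := hK.norm_yosidaSemigroup_le m ht.1 (x - K y)
  have h4 := hK.norm_yosidaSemigroup_le n ht.1 (x - K y)
  have h5 : ‖yosidaSemigroup K m t (K y) - yosidaSemigroup K n t (K y)‖ < r / 2 := by
    refine h2.trans_lt ?_
    have ht' : t < |T| + 1 := (ht.2.trans (le_abs_self T)).trans_lt (lt_add_one _)
    rcases ht.1.eq_or_lt with h0 | h0
    · rw [← h0, mul_zero]; positivity
    · calc _ < r / (2 * (|T| + 1)) * (|T| + 1) := by
            apply mul_lt_mul'' h1 ht' (norm_nonneg _) ht.1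
        _ = r / 2 := by field_simp
  have e : yosidaSemigroup K m t x - yosidaSemigroup K n t x =
      yosidaSemigroup K m t (x - K y) - yosidaSemigroup K n t (x - K y) +
      (yosidaSemigroup K m t (K y) - yosidaSemigroup K n t (K y)) := by
    simp only [map_sub]; abel
  rw [e]
  have h6 := norm_add_le (yosidaSemigroup K m t (x - K y) - yosidaSemigroup K n t (x - K y))
    (yosidaSemigroup K m t (K y) - yosidaSemigroup K n t (K y))
  have h7 := norm_sub_le (yosidaSemigroup K m t (x - K y)) (yosidaSemigroup K n t (x - K y))
  linarith

theorem exists_tendsto_yosidaSemigroup (hK : IsDissipative K) (hinj : ∀ x, K x = 0 → x = 0)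
    (t : ℝ≥0) : ∃ S : X →L[ℂ] X, ‖S‖ ≤ 1 ∧
      ∀ x, Tendsto (fun n => yosidaSemigroup K n t x) atTop (𝓝 (S x)) := by
  have h : ∀ x, ∃ y, Tendsto (fun n => yosidaSemigroup K n t x) atTop (𝓝 y) := fun x =>
    cauchySeq_tendsto_of_complete
      ((hK.uniformCauchySeqOn_yosidaSemigroup hinj x t).cauchySeq ⟨t.2, le_rfl⟩)
  choose f hf using h
  let g : X →ₗ[ℂ] X := linearMapOfTendsto f (fun n => (yosidaSemigroup K n t : X →ₗ[ℂ] X))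
    (l := atTop) (tendsto_pi_nhds.2 hf)
  have hg : ∀ x, ‖g x‖ ≤ 1 * ‖x‖ := fun x => by
    rw [one_mul]
    exact le_of_tendsto (hf x).norm (.of_forall fun n => hK.norm_yosidaSemigroup_le n t.2 x)
  exact ⟨g.mkContinuous 1 hg, g.mkContinuous_norm_le zero_le_one hg, hf⟩

/-- **Hille–Yosida theorem** for the inverse of a bounded injective dissipative operator. -/
theorem exists_semigroup (hK : IsDissipative K) (hinj : ∀ x, K x = 0 → x = 0) :
    ∃ S : ℝ≥0 → X →L[ℂ] X, IsContractionSemigroup S ∧ (∀ t x, S t (K x) = K (S t x)) ∧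
      ∀ (t : ℝ≥0) (x : X), S t (K x) = K x + ∫ s in (0 : ℝ)..t, S s.toNNReal x := by
  choose S hS1 hS using hK.exists_tendsto_yosidaSemigroup hinj
  have hcont : ∀ x, Continuous fun t : ℝ≥0 => S t x := by
    intro x
    -- Convergence is uniform only on bounded intervals, so continuity is proved on each and then
    -- localized.
    have hon : ∀ T : ℝ, ContinuousOn (fun t : ℝ => S t.toNNReal x) (Icc 0 T) := by
      intro T
      have hu : TendstoUniformlyOn (fun n (t : ℝ) => yosidaSemigroup K n t x)
          (fun t => S t.toNNReal x) atTop (Icc 0 T) :=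
        (hK.uniformCauchySeqOn_yosidaSemigroup hinj x T).tendstoUniformlyOn_of_tendsto
          fun t ht => by simpa [Real.coe_toNNReal t ht.1] using hS t.toNNReal x
      refine hu.continuousOn (Frequently.of_forall fun n => Continuous.continuousOn ?_)
      exact continuous_iff_continuousAt.2 fun s => (hasDerivAt_exp_smul_apply _ _ s).continuousAt
    have hall : ContinuousOn (fun t : ℝ => S t.toNNReal x) (Ici 0) := by
      intro t ht
      refine ((hon (t + 1)) t ⟨ht, by linarith⟩).mono_of_mem_nhdsWithin ?_
      rw [← Ici_inter_Iic]
      exact inter_mem self_mem_nhdsWithin (mem_nhdsWithin_of_mem_nhds (Iic_mem_nhds (by linarith)))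
    have := hall.comp_continuous (f := fun t : ℝ≥0 => (t : ℝ)) NNReal.continuous_coe fun t => t.2
    simpa [Function.comp_def] using this
  refine ⟨S, ⟨?_, fun s t => ?_, hcont, hS1⟩, fun t x => ?_, fun t x => ?_⟩
  · ext x
    refine tendsto_nhds_unique (hS 0 x) ?_
    simp [yosidaSemigroup]
  · ext x
    refine tendsto_nhds_unique (hS (s + t) x) ?_
    -- A product of strongly convergent contractions converges strongly: the error in the inner
    -- factor is not amplified by the outer one.
    have e : ∀ n, yosidaSemigroup K n ((s + t : ℝ≥0) : ℝ) x =
        yosidaSemigroup K n s (yosidaSemigroup K n t x - S t x) + yosidaSemigroup K n s (S t x) := by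
      intro n
      let : NormedAlgebra ℚ (X →L[ℂ] X) := NormedAlgebra.restrictScalars ℚ ℂ _
      rw [← map_add, sub_add_cancel, yosidaSemigroup, NNReal.coe_add, add_smul,
        NormedSpace.exp_add_of_commute ((Commute.refl _).smul_left _ |>.smul_right _)]
      rfl
    simp only [e]
    have h0 : Tendsto (fun n => yosidaSemigroup K n s (yosidaSemigroup K n t x - S t x)) atTop
        (𝓝 0) := by
      refine squeeze_zero_norm (fun n => hK.norm_yosidaSemigroup_le n s.2 _) ?_
      simpa using ((hS t x).sub_const (S t x)).norm
    simpa using h0.add (hS s (S t x))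
  · refine tendsto_nhds_unique (hS t (K x)) ?_
    have e : ∀ n, yosidaSemigroup K n t (K x) = K (yosidaSemigroup K n t x) := by
      intro n
      have : Commute K (yosidaSemigroup K n t) :=
        Commute.exp_right ((hK.commute_yosida Nat.one_div_pos_of_nat).smul_right _)
      exact congrArg (fun T : X →L[ℂ] X => T x) this.symm.eq
    simp only [e]
    exact (K.continuous.tendsto _).comp (hS t x)
  · refine tendsto_nhds_unique (hS t (K x)) ?_
    simp only [yosidaSemigroup_apply_eq_add_integral]
    refine Tendsto.const_add _ ?_
    -- The integrands are bounded by the norms of a convergent sequence, a constant bound that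
    -- permits dominated convergence.
    have hlim := hK.tendsto_yosida_seq hinj x
    obtain ⟨C, hC⟩ := hlim.norm.bddAbove_range
    refine intervalIntegral.tendsto_integral_filter_of_dominated_convergence (fun _ => C)
      (.of_forall fun n => ?_) (.of_forall fun n => .of_forall fun s hs => ?_) (by simp)
      (.of_forall fun s hs => ?_)
    · refine Continuous.aestronglyMeasurable ?_
      exact continuous_iff_continuousAt.2 fun s => (hasDerivAt_exp_smul_apply _ _ s).continuousAt
    · rw [uIoc_of_le t.coe_nonneg] at hs
      exact (hK.norm_yosidaSemigroup_le n hs.1.le _).trans (hC ⟨n, rfl⟩)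
    · rw [uIoc_of_le t.coe_nonneg] at hs
      have h1 := hS s.toNNReal x
      rw [Real.coe_toNNReal s hs.1.le] at h1
      have h0 : Tendsto (fun n => yosidaSemigroup K n s
          (yosida K (1 / ((n : ℝ) + 1)) (K x) - x)) atTop (𝓝 0) := by
        refine squeeze_zero_norm (fun n => hK.norm_yosidaSemigroup_le n hs.1.le _) ?_
        simpa using (hlim.sub_const x).norm
      simpa using h0.add h1

end IsDissipative
end Generation
end ThermoPlate

namespace ThermoPlate

/-! ### The Cauchy problem for an operator with bounded dissipative inverse -/

section AbstractCauchy

variable {X : Type*} [NormedAddCommGroup X] [InnerProductSpace ℂ X]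

/-- Thus `D(B^j)` is the range of `K^j`, and its graph is the bounded image of `X` under `z ↦ (K^j
z, z)`. -/
theorem mem_iter_graph_iff {B : X →ₗ.[ℂ] X} {K : X →L[ℂ] X}
    (hB : ∀ x y, (x, y) ∈ B.graph ↔ x = K y) (j : ℕ) (x y : X) :
    (x, y) ∈ (iter B j).graph ↔ x = (K ^ j) y := by
  induction j generalizing x y with
  | zero =>
    rw [LinearPMap.mem_graph_iff]
    simp only [pow_zero, one_apply_eq_self]
    constructor
    · rintro ⟨z, rfl, rfl⟩; rfl
    · rintro rfl; exact ⟨⟨x, trivial⟩, rfl, rfl⟩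
  | succ j ih =>
    rw [pow_succ']
    constructor
    · rw [LinearPMap.mem_graph_iff]
      rintro ⟨⟨z, ⟨w, hw, hwz⟩, hz⟩, h1, h2⟩
      subst h1 h2
      have e1 : z = K (B ⟨z, hz⟩) := (hB _ _).1 (B.mem_graph ⟨z, hz⟩)
      have hw' : w = ⟨z, hz⟩ := Subtype.ext hwz
      subst hw'
      have e2 := (ih _ _).1 ((iter B j).mem_graph ⟨_, hw⟩)
      exact e1.trans (congrArg K e2)
    · intro h
      have h1 : (x, (K ^ j) y) ∈ B.graph := (hB _ _).2 h
      have h2 : ((K ^ j) y, y) ∈ (iter B j).graph := (ih _ _).2 rfl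
      rw [LinearPMap.mem_graph_iff] at h1 h2
      obtain ⟨w, rfl, hw⟩ := h1
      obtain ⟨z, hz, hz2⟩ := h2
      dsimp only at hw hz hz2
      have hm : B w ∈ (iter B j).domain := by rw [hw, ← hz]; exact z.2
      rw [LinearPMap.mem_graph_iff]
      refine ⟨⟨w, ⟨w, hm, rfl⟩, w.2⟩, rfl, ?_⟩
      refine Eq.trans ?_ hz2
      exact congrArg (iter B j) (Subtype.ext (hw.trans hz.symm))

variable {S : ℝ≥0 → X →L[ℂ] X} {K : X →L[ℂ] X}

theorem IsContractionSemigroup.continuous_toNNReal (hS : IsContractionSemigroup S) (x : X) :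
    Continuous fun t : ℝ => S t.toNNReal x :=
  (hS.continuous x).comp continuous_real_toNNReal

variable [CompleteSpace X]

theorem IsContractionSemigroup.hasDerivWithinAt (hS : IsContractionSemigroup S)
    (hint : ∀ (t : ℝ≥0) (x : X), S t (K x) = K x + ∫ s in (0 : ℝ)..t, S s.toNNReal x)
    (x : X) {t : ℝ} (ht : t ∈ Ici (0 : ℝ)) :
    HasDerivWithinAt (fun s : ℝ => S s.toNNReal (K x)) (S t.toNNReal x) (Ici 0) t := by
  have hc := hS.continuous_toNNReal x
  have h1 : HasDerivAt (fun t : ℝ => K x + ∫ s in (0 : ℝ)..t, S s.toNNReal x) (S t.toNNReal x) t :=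
    (hc.integral_hasStrictDerivAt 0 t).hasDerivAt.const_add _
  have e : ∀ s ∈ Ici (0 : ℝ), S s.toNNReal (K x) = K x + ∫ r in (0 : ℝ)..s, S r.toNNReal x := by
    intro s hs
    have := hint s.toNNReal x
    rwa [Real.coe_toNNReal s hs] at this
  exact h1.hasDerivWithinAt.congr e (e t ht)

/-- Each factor `K` buys one derivative, since differentiating the orbit of `K x` gives the orbit of
`x`. -/
theorem IsContractionSemigroup.contDiffOn (hS : IsContractionSemigroup S)
    (hint : ∀ (t : ℝ≥0) (x : X), S t (K x) = K x + ∫ s in (0 : ℝ)..t, S s.toNNReal x)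
    (m : ℕ) (x : X) : ContDiffOn ℝ m (fun t : ℝ => S t.toNNReal ((K ^ m) x)) (Ici 0) := by
  induction m with
  | zero => simpa using (hS.continuous_toNNReal x).continuousOn
  | succ m ih =>
    rw [Nat.cast_succ, contDiffOn_succ_iff_derivWithin (uniqueDiffOn_Ici 0)]
    rw [pow_succ']
    have hd : ∀ t ∈ Ici (0 : ℝ), HasDerivWithinAt (fun t : ℝ => S t.toNNReal ((K * K ^ m) x))
        (S t.toNNReal ((K ^ m) x)) (Ici 0) t := fun t ht => hS.hasDerivWithinAt hint ((K ^ m) x) ht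
    refine ⟨fun t ht => (hd t ht).differentiableWithinAt, by simp, ih.congr fun t ht => ?_⟩
    exact (hd t ht).derivWithin (uniqueDiffOn_Ici 0 t ht)

/-- If the difference quotients at `x` tend to `y`, then `K` maps them to the quotients at `K x`,
which tend to `x`; hence `x = K y`. No separate maximality argument is required. -/
theorem IsContractionSemigroup.isGenerator {B : X →ₗ.[ℂ] X}
    (hB : ∀ x y, (x, y) ∈ B.graph ↔ x = K y)
    (hS : IsContractionSemigroup S) (hcomm : ∀ t x, S t (K x) = K (S t x))
    (hint : ∀ (t : ℝ≥0) (x : X), S t (K x) = K x + ∫ s in (0 : ℝ)..t, S s.toNNReal x) :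
    IsGenerator B S := by
  have key : ∀ y, Tendsto (fun t : ℝ≥0 => (t : ℝ)⁻¹ • (S t (K y) - K y)) (𝓝[>] 0) (𝓝 y) := by
    intro y
    have h1 := hS.hasDerivWithinAt hint y (t := 0) (mem_Ici.2 le_rfl)
    rw [hasDerivWithinAt_iff_tendsto_slope] at h1
    have h2 : Tendsto (fun t : ℝ≥0 => (t : ℝ)) (𝓝[>] 0) (𝓝[Ici 0 \ {0}] 0) := by
      refine tendsto_nhdsWithin_iff.2 ⟨?_, ?_⟩
      · exact (NNReal.continuous_coe.tendsto' 0 0 rfl).mono_left nhdsWithin_le_nhds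
      · filter_upwards [self_mem_nhdsWithin] with t ht
        exact ⟨t.2, (NNReal.coe_pos.2 ht).ne'⟩
    have h3 := h1.comp h2
    simpa [Function.comp_def, slope_def_module, hS.map_zero] using h3
  intro x y
  rw [hB]
  constructor
  · rintro rfl; exact key y
  · intro h
    have h1 := (K.continuous.tendsto y).comp h
    refine tendsto_nhds_unique (key x) (h1.congr fun t => ?_)
    have : K ((t : ℝ)⁻¹ • (S t x - x)) = (t : ℝ)⁻¹ • K (S t x - x) :=
      (K.restrictScalars ℝ).map_smul _ _
    simp only [Function.comp_def, this, map_sub, hcomm]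

/-- Uniqueness of weak solutions. -/
theorem IsWeakSolution.eqOn {B : X →ₗ.[ℂ] X} (hB : ∀ x y, (x, y) ∈ B.graph ↔ x = K y)
    (hK : IsDissipative K) (hinj : ∀ x, K x = 0 → x = 0) {U₀ : X} {U U' : ℝ → X}
    (hU : IsWeakSolution B U₀ U) (hU' : IsWeakSolution B U₀ U') : EqOn U' U (Ici 0) := by
  -- Weak solutions are controlled only for `t ≥ 0`; freezing the time at `0` makes the difference
  -- continuous on the whole line.
  let D : ℝ → X := fun t => U' (max t 0) - U (max t 0)
  have hmax : ∀ t ∈ Ici (0 : ℝ), max t 0 = t := fun t ht => max_eq_left ht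
  have hDc : Continuous D := by
    have hm : Continuous fun t : ℝ => max t 0 := continuous_id.max continuous_const
    exact (hU'.continuousOn.comp_continuous hm fun t => mem_Ici.2 (le_max_right _ _)).sub
      (hU.continuousOn.comp_continuous hm fun t => mem_Ici.2 (le_max_right _ _))
  have hD0 : D 0 = 0 := by simp [D, hU.initial, hU'.initial]
  let Z : ℝ → X := fun t => ∫ s in (0 : ℝ)..t, D s
  have hZ : ∀ t, HasDerivAt Z (D t) t := fun t => (hDc.integral_hasStrictDerivAt 0 t).hasDerivAt
  have hZ0 : Z 0 = 0 := intervalIntegral.integral_same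
  -- The test vectors `K* W` satisfy `B* (K* W) = W`, so the weak equation says that `K D` and `Z`
  -- have the same derivative against every `W`.
  have hKD : ∀ t ∈ Ici (0 : ℝ), K (D t) = Z t := by
    intro t ht
    refine ext_inner_left ℂ fun W => ?_
    have hV : ∀ x : B.domain, ⟪ContinuousLinearMap.adjoint K W, B x⟫_ℂ = ⟪W, (x : X)⟫_ℂ := by
      intro x
      rw [ContinuousLinearMap.adjoint_inner_left, ← (hB _ _).1 (B.mem_graph x)]
    have hd : ∀ s ∈ Ici (0 : ℝ), HasDerivWithinAt (fun s => ⟪W, K (D s)⟫_ℂ - ⟪W, Z s⟫_ℂ) 0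
        (Ici 0) s := by
      intro s hs
      have h1 := (hU'.weak _ _ hV s hs).sub (hU.weak _ _ hV s hs)
      have h2 : HasDerivWithinAt (fun s => ⟪W, K (D s)⟫_ℂ) ⟪W, D s⟫_ℂ (Ici 0) s := by
        have e : ∀ r ∈ Ici (0 : ℝ), ⟪W, K (D r)⟫_ℂ =
            ⟪ContinuousLinearMap.adjoint K W, U' r⟫_ℂ -
              ⟪ContinuousLinearMap.adjoint K W, U r⟫_ℂ := by
          intro r hr
          simp only [D, hmax r hr, map_sub, inner_sub_right, ContinuousLinearMap.adjoint_inner_left]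
        refine (h1.congr e (e s hs)).congr_deriv ?_
        simp only [D, hmax s hs, inner_sub_right]
      have h3 : HasDerivWithinAt (fun s => ⟪W, Z s⟫_ℂ) ⟪W, D s⟫_ℂ (Ici 0) s :=
        ((((innerSL ℂ W).restrictScalars ℝ).hasFDerivAt (x := Z s)).comp_hasDerivAt s
          (hZ s)).hasDerivWithinAt
      exact (h2.sub h3).congr_deriv (sub_self _)
    have := (convex_Ici (0 : ℝ)).norm_image_sub_le_of_norm_hasDerivWithin_le hd (C := 0)
      (fun s _ => by simp) (mem_Ici.2 le_rfl) ht
    simpa [hD0, hZ0, sub_eq_zero] using this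
  -- Energy estimate: `d/dt ‖Z‖² = 2 Re ⟨Z, D⟩ = 2 Re ⟨K D, D⟩ ≤ 0`, so `Z` stays `0` and the
  -- injectivity of `K` gives `D = 0`.
  have hd2 : ∀ s, HasDerivAt (fun s : ℝ => ‖Z s‖ ^ 2) (2 * (⟪Z s, D s⟫_ℂ).re) s := fun s => by
    have h1 := (hZ s).inner ℂ (hZ s)
    have h2 := Complex.reCLM.hasFDerivAt.comp_hasDerivAt s h1
    simp only [Function.comp_def, Complex.reCLM_apply, Complex.add_re, re_inner_self] at h2
    rw [re_inner_symm (D s), ← two_mul] at h2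
    exact h2
  have ha : AntitoneOn (fun s : ℝ => ‖Z s‖ ^ 2) (Ici 0) := by
    refine antitoneOn_of_deriv_nonpos (convex_Ici 0)
      (fun s _ => (hd2 s).continuousAt.continuousWithinAt)
      (fun s _ => (hd2 s).differentiableAt.differentiableWithinAt) fun s hs => ?_
    rw [(hd2 s).deriv, ← hKD s (interior_subset hs)]
    have := hK (D s)
    linarith
  intro t ht
  have h1 := ha (mem_Ici.2 le_rfl) ht ht
  simp only [hZ0, norm_zero] at h1
  have h2 : Z t = 0 := by
    have : ‖Z t‖ ^ 2 = 0 := le_antisymm (by simpa using h1) (by positivity)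
    simpa using this
  have h3 := hinj _ ((hKD t ht).trans h2)
  simpa [D, hmax t ht, sub_eq_zero] using h3

/-- Well-posedness of the abstract Cauchy problem for an operator whose inverse is bounded,
everywhere defined and dissipative. -/
theorem exists_semigroup_of_isDissipative_inverse {B : X →ₗ.[ℂ] X}
    (hB : ∀ x y, (x, y) ∈ B.graph ↔ x = K y) (hK : IsDissipative K) :
    ∃ S : ℝ≥0 → X →L[ℂ] X, IsContractionSemigroup S ∧ IsGenerator B S ∧
      ∀ U₀ : X, ∃ U : ℝ → X, IsWeakSolution B U₀ U ∧
        (∀ U' : ℝ → X, IsWeakSolution B U₀ U' → EqOn U' U (Ici 0)) ∧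
        (∀ t : ℝ≥0, U t = S t U₀) ∧
        ∀ k : ℕ, U₀ ∈ (iter B k).domain → ∀ j ≤ k, IsCkInDomain (k - j) (iter B j) U := by
  have hinj : ∀ x, K x = 0 → x = 0 := fun x hx =>
    B.graph_fst_eq_zero_snd ((hB 0 x).2 hx.symm) rfl
  obtain ⟨S, hS, hcomm, hint⟩ := hK.exists_semigroup hinj
  refine ⟨S, hS, hS.isGenerator hB hcomm hint, fun U₀ => ?_⟩
  have hweak : IsWeakSolution B U₀ fun t => S t.toNNReal U₀ := by
    refine ⟨(hS.continuous_toNNReal U₀).continuousOn, by simp [hS.map_zero], fun V W h t ht => ?_⟩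
    -- Every `y` equals `B (K y)`, which turns `B* V = W` into `V = K* W`.
    have hV : ∀ y, ⟪V, y⟫_ℂ = ⟪W, K y⟫_ℂ := by
      intro y
      obtain ⟨x, hx, hy⟩ := (LinearPMap.mem_graph_iff B).1 ((hB (K y) y).2 rfl)
      dsimp only at hx hy
      rw [← hx, ← hy]; exact h x
    simp only [hV, ← hcomm]
    exact ((innerSL ℂ W).restrictScalars ℝ).hasFDerivAt.comp_hasDerivWithinAt t
      (hS.hasDerivWithinAt hint U₀ ht)
  refine ⟨_, hweak, fun U' hU' => hweak.eqOn hB hK hinj hU', by simp, fun k hk j hj => ?_⟩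
  obtain ⟨y, hy⟩ := LinearPMap.mem_domain_iff.1 hk
  rw [mem_iter_graph_iff hB] at hy
  have hpow : ∀ (m : ℕ) t x, S t ((K ^ m) x) = (K ^ m) (S t x) := by
    intro m t
    induction m with
    | zero => simp
    | succ m ih => intro x; simp only [pow_succ', mul_apply_eq_comp, hcomm, ih]
  -- With `U₀ = K^k y`, the solution is `K^j` applied to the orbit of `K^(k-j) y`. That orbit is
  -- `C^(k-j)`, and `T` lifts it to the graph.
  let T : X →L[ℂ] (iter B j).graph := ((K ^ j).prod (ContinuousLinearMap.id ℂ X)).codRestrict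
    (iter B j).graph fun z => (mem_iter_graph_iff hB j _ _).2 rfl
  refine ⟨fun t => T (S t.toNNReal ((K ^ (k - j)) y)), ?_, fun t _ => ?_⟩
  · exact (T.restrictScalars ℝ).contDiff.comp_contDiffOn (hS.contDiffOn hint (k - j) y)
  · change (K ^ j) (S t.toNNReal ((K ^ (k - j)) y)) = S t.toNNReal U₀
    rw [hy, ← hpow, ← Nat.add_sub_cancel' hj, pow_add, Nat.add_sub_cancel_left,
      mul_apply_eq_comp]

end AbstractCauchy
end ThermoPlate

namespace ThermoPlate

/-! ### The bounded inverse of the Dirichlet Laplacian -/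

/-- The solution operator of the variational problem `⟨q v, q w⟩ = ⟨p v, f⟩` for all `v`. -/
theorem exists_isPositive_weak_solution_operator {V G H : Type*} [NormedAddCommGroup V]
    [NormedSpace ℂ V] [CompleteSpace V] [NormedAddCommGroup G] [InnerProductSpace ℂ G]
    [CompleteSpace G] [NormedAddCommGroup H] [InnerProductSpace ℂ H] [CompleteSpace H]
    (p : V →L[ℂ] H) {q : V →L[ℂ] G} {C : ℝ≥0} (hq : AntilipschitzWith C q) :
    ∃ T : H →L[ℂ] H, T.IsPositive ∧
      ∀ f, ∃ w, p w = T f ∧ ∀ v, ⟪q v, q w⟫_ℂ = ⟪p v, f⟫_ℂ := by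
  have hcl := hq.isClosed_range q.uniformContinuous
  let e := q.equivRange hq.injective hcl
  have : CompleteSpace q.range := by
    have : IsClosed (q.range : Set G) := hcl
    exact this.completeSpace_coe
  -- The energy space is replaced by the closed range of `q`, a Hilbert space, so `V` may carry any
  -- complete norm. Riesz representation is then the adjoint of `J = p ∘ q⁻¹`, and `J J*` is
  -- positive by construction.
  let J : q.range →L[ℂ] H := p ∘L (e.symm : q.range →L[ℂ] V)
  have hJ : ∀ w, J (e w) = p w := fun w => by simp [J]
  refine ⟨J ∘L ContinuousLinearMap.adjoint J, ContinuousLinearMap.isPositive_self_comp_adjoint J,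
    fun f => ?_⟩
  obtain ⟨w, hw⟩ := e.surjective (ContinuousLinearMap.adjoint J f)
  refine ⟨w, ?_, fun v => ?_⟩
  · rw [← hJ, hw]; rfl
  · have h1 := ContinuousLinearMap.adjoint_inner_right J (e v) f
    rw [← hw, hJ] at h1
    exact h1

section Dirichlet

variable {n : ℕ} {Ω : Set (EuclideanSpace ℝ (Fin n))}

/-- Poincaré's inequality on `H¹₀(Ω)`, for a bounded set `Ω`. -/
theorem H10_poincare (hn : 1 ≤ n) (hb : Bornology.IsBounded Ω) :
    ∃ C : ℝ≥0, ∀ w ∈ H10 Ω, ‖w.1‖ ≤ C * ‖w.2‖ := by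
  obtain ⟨R, hR⟩ := hb.exists_norm_le
  let i : Fin n := ⟨0, hn⟩
  have hc : IsClosed {w : L2 Ω × (Fin n → L2 Ω) | ‖w.1‖ ^ 2 ≤ 4 * R ^ 2 * ‖w.2 i‖ ^ 2} :=
    isClosed_le (by fun_prop) (by fun_prop)
  have ht : (testPairs Ω : Set (L2 Ω × (Fin n → L2 Ω))) ⊆
      {w | ‖w.1‖ ^ 2 ≤ 4 * R ^ 2 * ‖w.2 i‖ ^ 2} := by
    rintro ⟨p, q⟩ ⟨φ, h1, h2, h3, h4, h5⟩
    have hs : Function.support (fun x => fderiv ℝ φ x (EuclideanSpace.single i 1)) ⊆ Ω := by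
      intro x hx
      refine h3 (support_fderiv_subset ℝ ?_)
      intro h0
      apply hx
      simp [h0]
    simp only [mem_ofPred_eq]
    rw [norm_sq_eq_integral h4 ((subset_tsupport φ).trans h3),
      norm_sq_eq_integral (h5 i) hs]
    exact poincare_aux i h1 h2 fun x hx =>
      (PiLp.norm_apply_le x i).trans (hR x (h3 hx))
  refine ⟨⟨2 * |R|, by positivity⟩, fun w hw => ?_⟩
  have h : ‖w.1‖ ^ 2 ≤ 4 * R ^ 2 * ‖w.2 i‖ ^ 2 := closure_minimal ht hc hw
  have h2 : ‖w.1‖ ≤ 2 * |R| * ‖w.2 i‖ := by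
    refine le_of_sq_le_sq (h.trans_eq ?_) (by positivity)
    rw [mul_pow, mul_pow, sq_abs]; ring
  refine h2.trans ?_
  change _ ≤ 2 * |R| * ‖w.2‖
  gcongr
  exact norm_le_pi_norm w.2 i

/-- The bounded positive inverse of the Dirichlet Laplacian of a bounded open set. -/
theorem exists_dirichletLaplacian_inverse (hn : 1 ≤ n) (hΩ : IsOpen Ω)
    (hb : Bornology.IsBounded Ω) : ∃ T : L2 Ω →L[ℂ] L2 Ω, T.IsPositive ∧
      ∀ x y, (x, y) ∈ (dirichletLaplacian Ω).graph ↔ x = T y := by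
  have hg : (dirichletLaplacian Ω).graph = dirichletGraph Ω :=
    Submodule.toLinearPMap_graph_eq _ (dirichletGraph_single hΩ)
  obtain ⟨C, hC⟩ := H10_poincare hn hb
  have : IsClosed (H10 Ω : Set (L2 Ω × (Fin n → L2 Ω))) := Submodule.isClosed_topologicalClosure _
  have : CompleteSpace (H10 Ω) := this.completeSpace_coe
  -- The gradient takes values in the `ℓ²` product, whose inner product is the Dirichlet form; `H10`
  -- itself has the supremum norm.
  let q : H10 Ω →L[ℂ] PiLp 2 (fun _ : Fin n => L2 Ω) :=
    ((PiLp.continuousLinearEquiv 2 ℂ (fun _ : Fin n => L2 Ω)).symm :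
      (Fin n → L2 Ω) →L[ℂ] PiLp 2 (fun _ : Fin n => L2 Ω)) ∘L
      (ContinuousLinearMap.snd ℂ (L2 Ω) (Fin n → L2 Ω)) ∘L (H10 Ω).subtypeL
  have hq : ∀ w i, (q w).ofLp i = w.1.2 i := fun w i => rfl
  have hq2 : ∀ w : H10 Ω, ‖w.1.2‖ ≤ ‖q w‖ := fun w =>
    (pi_norm_le_iff_of_nonneg (norm_nonneg _)).2 fun i => by
      rw [← hq]; exact PiLp.norm_apply_le (q w) i
  have hanti : AntilipschitzWith (max C 1) q := by
    refine q.antilipschitz_of_bound fun w => ?_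
    have h1 : ‖w.1.1‖ ≤ C * ‖w.1.2‖ := hC w.1 w.2
    have h2 := hq2 w
    rw [show ‖w‖ = max ‖w.1.1‖ ‖w.1.2‖ from rfl, NNReal.coe_max, NNReal.coe_one]
    refine max_le (h1.trans ?_) (h2.trans ?_)
    · gcongr
      exact le_max_left _ _
    · exact le_mul_of_one_le_left (norm_nonneg _) (le_max_right _ _)
  have hcl := hanti.isClosed_range q.uniformContinuous
  obtain ⟨T, hT, hsol⟩ := exists_isPositive_weak_solution_operator
    ((ContinuousLinearMap.fst ℂ (L2 Ω) (Fin n → L2 Ω)) ∘L (H10 Ω).subtypeL) hanti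
  have hmem : ∀ f, (T f, f) ∈ dirichletGraph Ω := by
    intro f
    obtain ⟨w, hw, hw2⟩ := hsol f
    refine ⟨w.1.2, ?_, fun v hv => ?_⟩
    · rw [← hw]; exact w.2
    · have h1 := hw2 ⟨v, (testPairs Ω).le_topologicalClosure hv⟩
      rw [PiLp.inner_apply] at h1
      exact h1
  refine ⟨T, hT, fun x y => ?_⟩
  rw [hg]
  constructor
  · intro h
    -- The pair `(x - T y, 0)` lies in the graph, so injectivity of the Laplacian gives `x = T y`.
    have h1 := (dirichletGraph Ω).sub_mem h (hmem y)
    rw [Prod.mk_sub_mk, sub_self, ← hg, LinearPMap.mem_graph_iff] at h1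
    obtain ⟨z, hz1, hz2⟩ := h1
    rw [dirichletLaplacian_injective hn hΩ hb hz2] at hz1
    exact sub_eq_zero.1 hz1.symm
  · rintro rfl; exact hmem y

end Dirichlet

/-! ### Fractional powers -/

section Powers

variable {H : Type*} [NormedAddCommGroup H] [InnerProductSpace ℂ H]
  {A : H →ₗ.[ℂ] H} {T : H →L[ℂ] H}

theorem boundedInverse_eq (h : ∀ x y, (x, y) ∈ A.graph ↔ x = T y) : boundedInverse A = T := by
  have hT : ∃ T : H →L[ℂ] H, (∀ u : A.domain, T (A u) = u) ∧
      ∀ f : H, ∃ u : A.domain, (u : H) = T f ∧ A u = f :=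
    ⟨T, fun u => ((h _ _).1 (A.mem_graph u)).symm,
      fun f => (LinearPMap.mem_graph_iff A).1 ((h _ _).2 rfl)⟩
  rw [boundedInverse, dif_pos hT]
  ext f
  obtain ⟨u, h1, h2⟩ := hT.choose_spec.2 f
  rw [← h1, (h _ _).1 (A.mem_graph u), h2]

variable [CompleteSpace H]

/-- The functional calculus is multiplicative and `x^s x^r = x` on the spectrum, which lies in `[0,
∞)`. Nonnegative exponents are enough even at `x = 0`, so `s = 0` is allowed, as needed for `τ = 0`.
-/
theorem negPow_mul_negPow (hT : T.IsPositive) (h : ∀ x y, (x, y) ∈ A.graph ↔ x = T y) {s r : ℝ}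
    (hs : 0 ≤ s) (hr : 0 ≤ r) (hsr : s + r = 1) : negPow A s * negPow A r = T := by
  have hsa : IsSelfAdjoint T := hT.isSelfAdjoint
  have hc : ∀ {a : ℝ}, 0 ≤ a → ContinuousOn (fun x : ℝ => x ^ a) (spectrum ℝ T) := fun ha =>
    (continuous_id.rpow_const fun _ => Or.inr ha).continuousOn
  rw [negPow, negPow, boundedInverse_eq h, ← cfc_mul _ _ T (hc hs) (hc hr)]
  conv_rhs => rw [← cfc_id' ℝ T]
  refine cfc_congr fun x hx => ?_
  have hx0 : 0 ≤ x := spectrum_nonneg_of_nonneg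
    ((ContinuousLinearMap.nonneg_iff_isPositive T).2 hT) hx
  change x ^ s * x ^ r = x
  rw [← Real.rpow_add_of_nonneg hx0 hs hr, hsr, Real.rpow_one]

theorem negPow_isSelfAdjoint (A : H →ₗ.[ℂ] H) (s : ℝ) : IsSelfAdjoint (negPow A s) :=
  cfc_predicate _ _

theorem mem_posPow_graph_iff {s : ℝ} (hinj : ∀ x, negPow A s x = 0 → x = 0) (x y : H) :
    (x, y) ∈ (posPow A s).graph ↔ x = negPow A s y := by
  have hk : LinearMap.ker ((negPow A s).toLinearMap.toPMap ⊤).toFun = ⊥ := by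
    rw [LinearMap.ker_eq_bot']
    intro z hz
    exact Subtype.ext (hinj _ hz)
  rw [posPow, LinearPMap.inverse_graph hk, Submodule.mem_map]
  constructor
  · rintro ⟨⟨a, b⟩, h1, h2⟩
    rw [LinearPMap.mem_graph_iff] at h1
    obtain ⟨z, h3, h4⟩ := h1
    cases h2
    dsimp only at h3 h4
    subst h3 h4
    rfl
  · rintro rfl
    exact ⟨(y, negPow A s y), (LinearPMap.mem_graph_iff _).2 ⟨⟨y, trivial⟩, rfl, rfl⟩, rfl⟩

end Powers
end ThermoPlate

/-! ### The powers of `A` in the plate system -/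

namespace ThermoPlate.PlateSystem

open PhaseSpace

variable {n : ℕ} (P : PlateSystem n)

/-- The operator `A⁻¹`. -/
def Ainv : L2 P.Ω →L[ℂ] L2 P.Ω :=
  (exists_dirichletLaplacian_inverse P.one_le P.isOpen P.isBounded).choose

theorem Ainv_isPositive : P.Ainv.IsPositive :=
  (exists_dirichletLaplacian_inverse P.one_le P.isOpen P.isBounded).choose_spec.1

theorem mem_A_graph_iff (x y : L2 P.Ω) : (x, y) ∈ P.A.graph ↔ x = P.Ainv y :=
  (exists_dirichletLaplacian_inverse P.one_le P.isOpen P.isBounded).choose_spec.2 x y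

theorem Ainv_injective {y : L2 P.Ω} (h : P.Ainv y = 0) : y = 0 :=
  P.A.graph_fst_eq_zero_snd ((P.mem_A_graph_iff 0 y).2 h.symm) rfl

theorem Ainv_A (x : P.A.domain) : P.Ainv (P.A x) = x :=
  ((P.mem_A_graph_iff _ _).1 (P.A.mem_graph x)).symm

theorem A_eq {x : P.A.domain} {y : L2 P.Ω} (h : (x : L2 P.Ω) = P.Ainv y) : P.A x = y :=
  P.A.mem_graph_snd_inj (P.A.mem_graph x) ((P.mem_A_graph_iff _ _).2 h) rfl

/-- The operator `A^{-τ/2}`. -/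
def N : L2 P.Ω →L[ℂ] L2 P.Ω := negPow P.A (P.τ / 2)

/-- The operator `A^{-(1-τ/2)}`. -/
def M : L2 P.Ω →L[ℂ] L2 P.Ω := negPow P.A (1 - P.τ / 2)

theorem N_M (x : L2 P.Ω) : P.N (P.M x) = P.Ainv x := by
  have h0 := P.τ_nonneg; have h1 := P.τ_le_one
  exact congrArg (fun S : L2 P.Ω →L[ℂ] L2 P.Ω => S x)
    (negPow_mul_negPow P.Ainv_isPositive P.mem_A_graph_iff (s := P.τ / 2) (r := 1 - P.τ / 2)
      (by linarith) (by linarith) (by ring))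

theorem M_N (x : L2 P.Ω) : P.M (P.N x) = P.Ainv x := by
  have h0 := P.τ_nonneg; have h1 := P.τ_le_one
  exact congrArg (fun S : L2 P.Ω →L[ℂ] L2 P.Ω => S x)
    (negPow_mul_negPow P.Ainv_isPositive P.mem_A_graph_iff (s := 1 - P.τ / 2) (r := P.τ / 2)
      (by linarith) (by linarith) (by ring))

theorem N_injective {y : L2 P.Ω} (h : P.N y = 0) : y = 0 :=
  P.Ainv_injective (by rw [← P.M_N, h, map_zero])

theorem M_injective {y : L2 P.Ω} (h : P.M y = 0) : y = 0 :=
  P.Ainv_injective (by rw [← P.N_M, h, map_zero])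

theorem inner_N (x y : L2 P.Ω) : ⟪P.N x, y⟫_ℂ = ⟪x, P.N y⟫_ℂ :=
  (ContinuousLinearMap.isSelfAdjoint_iff_isSymmetric.1 (negPow_isSelfAdjoint P.A _)) x y

theorem inner_M (x y : L2 P.Ω) : ⟪P.M x, y⟫_ℂ = ⟪x, P.M y⟫_ℂ :=
  (ContinuousLinearMap.isSelfAdjoint_iff_isSymmetric.1 (negPow_isSelfAdjoint P.A _)) x y

theorem mem_Apow_graph_iff (x y : L2 P.Ω) : (x, y) ∈ (P.Apow (P.τ / 2)).graph ↔ x = P.N y :=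
  mem_posPow_graph_iff (fun _ h => P.N_injective h) x y

theorem mem_Apow_graph_iff' (x y : L2 P.Ω) :
    (x, y) ∈ (P.Apow (1 - P.τ / 2)).graph ↔ x = P.M y :=
  mem_posPow_graph_iff (fun _ h => P.M_injective h) x y

theorem N_Apow (x : (P.Apow (P.τ / 2)).domain) : P.N (P.Apow (P.τ / 2) x) = x :=
  ((P.mem_Apow_graph_iff _ _).1 ((P.Apow (P.τ / 2)).mem_graph x)).symm

theorem Apow_eq {x : (P.Apow (P.τ / 2)).domain} {y : L2 P.Ω} (h : (x : L2 P.Ω) = P.N y) :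
    P.Apow (P.τ / 2) x = y :=
  (P.Apow (P.τ / 2)).mem_graph_snd_inj ((P.Apow (P.τ / 2)).mem_graph x)
    ((P.mem_Apow_graph_iff _ _).2 h) rfl

theorem M_Apow (x : (P.Apow (1 - P.τ / 2)).domain) : P.M (P.Apow (1 - P.τ / 2) x) = x :=
  ((P.mem_Apow_graph_iff' _ _).1 ((P.Apow (1 - P.τ / 2)).mem_graph x)).symm

theorem Apow_eq' {x : (P.Apow (1 - P.τ / 2)).domain} {y : L2 P.Ω} (h : (x : L2 P.Ω) = P.M y) :
    P.Apow (1 - P.τ / 2) x = y :=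
  (P.Apow (1 - P.τ / 2)).mem_graph_snd_inj ((P.Apow (1 - P.τ / 2)).mem_graph x)
    ((P.mem_Apow_graph_iff' _ _).2 h) rfl

theorem Ainv_mem (y : L2 P.Ω) : P.Ainv y ∈ P.A.domain :=
  LinearPMap.mem_domain_iff.2 ⟨y, (P.mem_A_graph_iff _ _).2 rfl⟩

theorem N_mem (y : L2 P.Ω) : P.N y ∈ (P.Apow (P.τ / 2)).domain :=
  LinearPMap.mem_domain_iff.2 ⟨y, (P.mem_Apow_graph_iff _ _).2 rfl⟩

theorem M_mem (y : L2 P.Ω) : P.M y ∈ (P.Apow (1 - P.τ / 2)).domain :=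
  LinearPMap.mem_domain_iff.2 ⟨y, (P.mem_Apow_graph_iff' _ _).2 rfl⟩

/-! ### The phase space as a product of copies of `L²` -/

/-- The coordinates `(A u, A^{τ/2} v, θ) ∈ L² × L² × L²` of the element `(u, v, θ)` of the phase
space. -/
def coordLinear : P.PhaseSpace ≃ₗ[ℂ] L2 P.Ω × L2 P.Ω × L2 P.Ω where
  toLinearMap := (P.A.toFun ∘ₗ u).prod (((P.Apow (P.τ / 2)).toFun ∘ₗ v).prod θ)
  invFun x := (⟨P.Ainv x.1, P.Ainv_mem _⟩, ⟨P.N x.2.1, P.N_mem _⟩, x.2.2)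
  left_inv U := ext' (Subtype.ext (P.Ainv_A (u U))) (Subtype.ext (P.N_Apow (v U))) rfl
  right_inv _ := Prod.ext (P.A_eq rfl) (Prod.ext (P.Apow_eq rfl) rfl)

theorem inner_eq (U V : P.PhaseSpace) : ⟪U, V⟫_ℂ =
    P.β * ⟪(P.coordLinear U).1, (P.coordLinear V).1⟫_ℂ +
    P.β * (⟪P.N (P.coordLinear U).2.1, P.N (P.coordLinear V).2.1⟫_ℂ +
      P.γ * ⟪(P.coordLinear U).2.1, (P.coordLinear V).2.1⟫_ℂ) +
    P.α * ⟪(P.coordLinear U).2.2, (P.coordLinear V).2.2⟫_ℂ := by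
  have h : ∀ U : P.PhaseSpace, P.N (P.coordLinear U).2.1 = v U := fun U => P.N_Apow (v U)
  rw [h, h]
  rfl

theorem norm_sq_eq (U : P.PhaseSpace) : ‖U‖ ^ 2 =
    P.β * ‖(P.coordLinear U).1‖ ^ 2 +
    P.β * (‖P.N (P.coordLinear U).2.1‖ ^ 2 + P.γ * ‖(P.coordLinear U).2.1‖ ^ 2) +
    P.α * ‖(P.coordLinear U).2.2‖ ^ 2 := by
  rw [← re_inner_self, inner_eq]
  simp only [Complex.add_re, Complex.re_ofReal_mul, re_inner_self]

theorem norm_coordLinear_le (U : P.PhaseSpace) :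
    ‖P.coordLinear U‖ ≤ √(1 / P.β + 1 / (P.β * P.γ) + 1 / P.α) * ‖U‖ := by
  have hα := P.α_pos; have hβ := P.β_pos; have hγ := P.γ_pos
  have h := P.norm_sq_eq U
  set x := P.coordLinear U
  -- Each coordinate is controlled by its own weight in the energy, `β`, `β γ` or `α`; the term with
  -- `P.N` is not needed.
  have key : ∀ {y : L2 P.Ω} {c : ℝ}, 0 < c → c * ‖y‖ ^ 2 ≤ ‖U‖ ^ 2 →
      1 / c ≤ 1 / P.β + 1 / (P.β * P.γ) + 1 / P.α →
      ‖y‖ ≤ √(1 / P.β + 1 / (P.β * P.γ) + 1 / P.α) * ‖U‖ := by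
    intro y c hc h1 h2
    refine le_of_sq_le_sq ?_ (by positivity)
    rw [mul_pow, Real.sq_sqrt (by positivity)]
    calc ‖y‖ ^ 2 = 1 / c * (c * ‖y‖ ^ 2) := by field_simp
      _ ≤ _ := by gcongr
  have a1 : 0 ≤ P.β * ‖x.1‖ ^ 2 := by positivity
  have a2 : 0 ≤ P.β * ‖P.N x.2.1‖ ^ 2 := by positivity
  have a3 : 0 ≤ P.β * P.γ * ‖x.2.1‖ ^ 2 := by positivity
  have a4 : 0 ≤ P.α * ‖x.2.2‖ ^ 2 := by positivity
  have b1 : 0 ≤ 1 / P.β := by positivity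
  have b2 : 0 ≤ 1 / (P.β * P.γ) := by positivity
  have b3 : 0 ≤ 1 / P.α := by positivity
  refine max_le (key hβ (by linarith) (by linarith)) (max_le (key (mul_pos hβ hγ) (by linarith)
    (by linarith)) (key hα (by linarith) (by linarith)))

theorem norm_coordLinear_symm_le (x : L2 P.Ω × L2 P.Ω × L2 P.Ω) :
    ‖P.coordLinear.symm x‖ ≤ √(P.β + P.β * (‖P.N‖ ^ 2 + P.γ) + P.α) * ‖x‖ := by
  have hα := P.α_pos; have hβ := P.β_pos; have hγ := P.γ_pos
  refine le_of_sq_le_sq ?_ (by positivity)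
  rw [mul_pow, Real.sq_sqrt (by positivity), norm_sq_eq, LinearEquiv.apply_symm_apply]
  have h1 : ‖x.1‖ ≤ ‖x‖ := norm_fst_le x
  have h2 : ‖x.2.1‖ ≤ ‖x‖ := (norm_fst_le x.2).trans (norm_snd_le x)
  have h3 : ‖x.2.2‖ ≤ ‖x‖ := (norm_snd_le x.2).trans (norm_snd_le x)
  have h4 : ‖P.N x.2.1‖ ≤ ‖P.N‖ * ‖x‖ := P.N.le_opNorm_of_le h2
  calc _ ≤ P.β * ‖x‖ ^ 2 + P.β * ((‖P.N‖ * ‖x‖) ^ 2 + P.γ * ‖x‖ ^ 2) + P.α * ‖x‖ ^ 2 := by gcongr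
    _ = _ := by ring

/-- The coordinates `(A u, A^{τ/2} v, θ)` of `(u, v, θ)`, as an isomorphism of normed spaces. -/
def coord : P.PhaseSpace ≃L[ℂ] L2 P.Ω × L2 P.Ω × L2 P.Ω :=
  P.coordLinear.toContinuousLinearEquivOfBounds _ _ P.norm_coordLinear_le
    P.norm_coordLinear_symm_le

theorem completeSpace_phaseSpace : CompleteSpace P.PhaseSpace :=
  (completeSpace_congr (e := P.coord.toEquiv) P.coord.isUniformEmbedding).2 inferInstance

/-! ### The operator `𝔹` and its inverse -/

/-- The operator `𝔹` in terms of bounded operators. -/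
theorem mem_B_graph_iff (U F : P.PhaseSpace) : (U, F) ∈ P.B.graph ↔
    (v U : L2 P.Ω) = u F ∧
    -P.A (u U) + (P.α : ℂ) • θ U =
      P.M (P.N (v F : L2 P.Ω) + (P.γ : ℂ) • P.Apow (P.τ / 2) (v F)) ∧
    -(P.κ : ℂ) • θ U - (P.β : ℂ) • (v U : L2 P.Ω) = P.Ainv (θ F) := by
  rw [B_graph]
  -- Substituting `z = A^{-τ/2} A^{τ/2} z` moves the whole pairing onto `A^{τ/2} z`, which ranges
  -- over all of `L²`; the dual equation becomes an equation in `L²`.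
  have hrot : ∀ z : (P.Apow (P.τ / 2)).domain, P.rot z (v F) =
      ⟪P.Apow (P.τ / 2) z, P.N (v F : L2 P.Ω) + (P.γ : ℂ) • P.Apow (P.τ / 2) (v F)⟫_ℂ := by
    intro z
    rw [rot, inner_add_right, inner_smul_right, ← inner_N, P.N_Apow]
  constructor
  · rintro ⟨h, e1, e2, e3⟩
    dsimp only at h e1 e2 e3
    refine ⟨(congrArg Subtype.val e1).symm, ?_, ?_⟩
    · have h2 : P.N (v F : L2 P.Ω) + (P.γ : ℂ) • P.Apow (P.τ / 2) (v F) =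
          P.Apow (1 - P.τ / 2) ⟨_, h.w_mem⟩ := by
        refine ext_inner_left ℂ fun y => ?_
        have h3 := e2 ⟨P.N y, P.N_mem y⟩
        rw [hrot, P.Apow_eq rfl] at h3
        exact h3
      rw [h2, P.M_Apow]
    · rw [e3, P.Ainv_A]
  · rintro ⟨h1, h2, h3⟩
    have hd : P.InDomain U := ⟨by rw [h1]; exact (u F).2, by rw [h2]; exact P.M_mem _,
      by rw [h3]; exact P.Ainv_mem _⟩
    refine ⟨hd, Subtype.ext h1.symm, fun z => ?_, (P.A_eq h3).symm⟩
    refine (hrot z).trans ?_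
    rw [P.Apow_eq' h2]

/-- The operator `A^{-τ} + γ` is onto. -/
theorem exists_N_N_add (y : L2 P.Ω) : ∃ g, P.N (P.N g) + (P.γ : ℂ) • g = y := by
  -- Coercivity: `Re ⟨(N² + γ) x, x⟩ = ‖N x‖² + γ ‖x‖²`.
  have hu : IsUnit (P.N ∘L P.N + (P.γ : ℂ) • (1 : L2 P.Ω →L[ℂ] L2 P.Ω)) := by
    refine ContinuousLinearMap.isUnit_of_forall_le_norm_inner_map _ (c := ⟨P.γ, P.γ_pos.le⟩)
      P.γ_pos fun x => ?_
    refine le_trans ?_ (Complex.abs_re_le_norm _)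
    refine le_trans ?_ (le_abs_self _)
    change ‖x‖ ^ 2 * P.γ ≤ (⟪P.N (P.N x) + (P.γ : ℂ) • x, x⟫_ℂ).re
    rw [inner_add_left, inner_N, inner_smul_left, Complex.conj_ofReal, Complex.add_re,
      Complex.re_ofReal_mul, re_inner_self, re_inner_self, mul_comm]
    exact le_add_of_nonneg_left (by positivity)
  obtain ⟨g, hg⟩ := (ContinuousLinearMap.isUnit_iff_bijective.1 hu).2 y
  exact ⟨g, hg⟩

/-- This is where `(I + γ A^τ)⁻¹` is shown to exist: the velocity `A^{-τ/2} g` solves the dual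
equation when `(A^{-τ} + γ) g = A^{1-τ/2} (-A u + α θ)`. -/
theorem mem_B_domain_iff (U : P.PhaseSpace) : U ∈ P.B.domain ↔ P.InDomain U := by
  constructor
  · intro h
    obtain ⟨F, hF⟩ := LinearPMap.mem_domain_iff.1 h
    rw [B_graph] at hF
    exact hF.choose
  · intro h
    obtain ⟨g, hg⟩ := P.exists_N_N_add (P.Apow (1 - P.τ / 2) ⟨_, h.w_mem⟩)
    let F : P.PhaseSpace := (⟨v U, h.v_mem⟩, ⟨P.N g, P.N_mem g⟩, P.A ⟨_, h.q_mem⟩)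
    refine LinearPMap.mem_domain_iff.2 ⟨F, (P.mem_B_graph_iff U F).2 ⟨rfl, ?_, ?_⟩⟩
    · have : P.Apow (P.τ / 2) (v F) = g := P.Apow_eq rfl
      rw [this]
      change _ = P.M (P.N (P.N g) + (P.γ : ℂ) • g)
      rw [hg, P.M_Apow]
    · exact (P.Ainv_A ⟨_, h.q_mem⟩).symm

/-- The temperature component of `𝔹⁻¹`, in the coordinates of the phase space. -/
def BinvTemp : L2 P.Ω × L2 P.Ω × L2 P.Ω →L[ℂ] L2 P.Ω :=
  (-(P.κ : ℂ)⁻¹) • P.Ainv ∘L (ContinuousLinearMap.snd ℂ _ _ ∘L ContinuousLinearMap.snd ℂ _ _ +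
    (P.β : ℂ) • ContinuousLinearMap.fst ℂ _ _)

/-- The operator `𝔹⁻¹` in the coordinates of the phase space. -/
def BinvCoord : L2 P.Ω × L2 P.Ω × L2 P.Ω →L[ℂ] L2 P.Ω × L2 P.Ω × L2 P.Ω :=
  ((P.α : ℂ) • P.BinvTemp - P.M ∘L (P.N ∘L P.N + (P.γ : ℂ) • 1) ∘L
    ContinuousLinearMap.fst ℂ _ _ ∘L ContinuousLinearMap.snd ℂ _ _).prod
    ((P.M ∘L ContinuousLinearMap.fst ℂ _ _).prod P.BinvTemp)

theorem BinvTemp_apply (x : L2 P.Ω × L2 P.Ω × L2 P.Ω) :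
    P.BinvTemp x = (-(P.κ : ℂ)⁻¹) • P.Ainv (x.2.2 + (P.β : ℂ) • x.1) := rfl

theorem BinvCoord_apply (x : L2 P.Ω × L2 P.Ω × L2 P.Ω) :
    P.BinvCoord x = ((P.α : ℂ) • P.BinvTemp x - P.M (P.N (P.N x.2.1) + (P.γ : ℂ) • x.2.1),
      P.M x.1, P.BinvTemp x) := rfl

/-- The bounded operator `𝔹⁻¹` on the phase space. -/
def Binv : P.PhaseSpace →L[ℂ] P.PhaseSpace :=
  (P.coord.symm : L2 P.Ω × L2 P.Ω × L2 P.Ω →L[ℂ] P.PhaseSpace) ∘L P.BinvCoord ∘L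
    (P.coord : P.PhaseSpace →L[ℂ] L2 P.Ω × L2 P.Ω × L2 P.Ω)

theorem coordLinear_Binv (F : P.PhaseSpace) :
    P.coordLinear (P.Binv F) = P.BinvCoord (P.coordLinear F) :=
  P.coordLinear.apply_symm_apply _

/-- The system is triangular: `v` is read off from `F`, the heat equation then gives `θ`, and the
plate equation gives `A u`. The velocity coordinate comes from `v = A⁻¹ (A v) = A^{-τ/2}
A^{-(1-τ/2)} A v`. -/
theorem mem_B_graph_iff_eq_Binv (U F : P.PhaseSpace) :
    (U, F) ∈ P.B.graph ↔ U = P.Binv F := by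
  have hκ : (P.κ : ℂ) ≠ 0 := by exact_mod_cast P.κ_pos.ne'
  have hv : (v U : L2 P.Ω) = u F ↔ P.Apow (P.τ / 2) (v U) = P.M (P.A (u F)) := by
    rw [← P.Ainv_A (u F), ← P.N_M]
    exact ⟨fun h => P.Apow_eq h, fun h => by rw [← h, P.N_Apow]⟩
  rw [mem_B_graph_iff, ← P.coordLinear.injective.eq_iff, coordLinear_Binv, BinvCoord_apply,
    BinvTemp_apply, Prod.ext_iff, Prod.ext_iff, hv]
  change _ ↔ P.A (u U) = (P.α : ℂ) • (-(P.κ : ℂ)⁻¹) • P.Ainv (θ F + (P.β : ℂ) • P.A (u F)) -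
      P.M (P.N (P.N (P.Apow (P.τ / 2) (v F))) + (P.γ : ℂ) • P.Apow (P.τ / 2) (v F)) ∧
    P.Apow (P.τ / 2) (v U) = P.M (P.A (u F)) ∧
    θ U = (-(P.κ : ℂ)⁻¹) • P.Ainv (θ F + (P.β : ℂ) • P.A (u F))
  rw [P.N_Apow, map_add P.Ainv, map_smul P.Ainv, P.Ainv_A]
  constructor
  · rintro ⟨h1, h2, h3⟩
    have h4 : θ U = (-(P.κ : ℂ)⁻¹) • (P.Ainv (θ F) + (P.β : ℂ) • (u F : L2 P.Ω)) := by
      rw [← h3, ← hv.2 h1, sub_add_cancel, smul_smul, neg_mul_neg, inv_mul_cancel₀ hκ, one_smul]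
    refine ⟨?_, h1, h4⟩
    rw [← h2, ← h4]; abel
  · rintro ⟨h1, h2, h3⟩
    refine ⟨h2, ?_, ?_⟩
    · rw [h1, h3]; abel
    · rw [h3, hv.2 h2, smul_smul, neg_mul_neg, mul_inv_cancel₀ hκ, one_smul, add_sub_cancel_right]

/-- By the symmetry of `P.M` and `P.N`, the plate terms of the first two components cancel in the
real part. With `y = x.2.2 + β x.1`, what remains is `-(α/κ) ⟨A⁻¹ y, y⟩`. -/
theorem isDissipative_Binv : IsDissipative P.Binv := by
  intro F
  have hα := P.α_pos; have hκ := P.κ_pos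
  rw [inner_eq, coordLinear_Binv]
  generalize P.coordLinear F = x
  rw [BinvCoord_apply]
  have h1 : (⟪P.M (P.N (P.N x.2.1)), x.1⟫_ℂ).re = (⟪P.N (P.M x.1), P.N x.2.1⟫_ℂ).re := by
    rw [inner_M, inner_N, re_inner_symm, inner_N]
  have h2 : (⟪P.M x.2.1, x.1⟫_ℂ).re = (⟪P.M x.1, x.2.1⟫_ℂ).re := by
    rw [inner_M, re_inner_symm]
  -- The coupling `α θ` in the plate equation, weighted by `β`, completes the thermal term to a
  -- pairing with `x.2.2 + β x.1`, the very vector to which `BinvTemp` applies `-κ⁻¹ A⁻¹`.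
  have h3 : P.β * (⟪P.BinvTemp x, x.1⟫_ℂ).re + (⟪P.BinvTemp x, x.2.2⟫_ℂ).re ≤ 0 := by
    have h4 := P.Ainv_isPositive.re_inner_nonneg_left (x.2.2 + (P.β : ℂ) • x.1)
    have h5 : (⟪P.BinvTemp x, x.2.2 + (P.β : ℂ) • x.1⟫_ℂ).re ≤ 0 := by
      rw [BinvTemp_apply, ← Complex.ofReal_inv, ← Complex.ofReal_neg, inner_smul_left,
        Complex.conj_ofReal, Complex.re_ofReal_mul]
      exact mul_nonpos_of_nonpos_of_nonneg (by simpa using hκ.le) h4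
    rw [inner_add_right, inner_smul_right, Complex.add_re, Complex.re_ofReal_mul] at h5
    linarith
  simp only [Complex.add_re, Complex.sub_re, Complex.re_ofReal_mul, inner_sub_left, inner_smul_left,
    Complex.conj_ofReal, map_add, map_smul, inner_add_left, h1, h2]
  have := mul_nonpos_of_nonneg_of_nonpos hα.le h3
  linarith

end ThermoPlate.PlateSystem

end

theorem theorem2 {n : ℕ} (P : ThermoPlate.PlateSystem n) :
    -- the phase space is a Hilbert space, and `𝔹` has the domain described above
    CompleteSpace P.PhaseSpace ∧
    (∀ U : P.PhaseSpace, U ∈ P.B.domain ↔ P.InDomain U) ∧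
    -- `𝔹` generates a `C₀`-semigroup of contractions
    ∃ S : ℝ≥0 → P.PhaseSpace →L[ℂ] P.PhaseSpace,
      ThermoPlate.IsContractionSemigroup S ∧
      ThermoPlate.IsGenerator P.B S ∧
      -- existence and uniqueness of the weak solution
      ∀ U₀ : P.PhaseSpace, ∃ U : ℝ → P.PhaseSpace,
        ThermoPlate.IsWeakSolution P.B U₀ U ∧
        (∀ U' : ℝ → P.PhaseSpace, ThermoPlate.IsWeakSolution P.B U₀ U' → EqOn U' U (Ici 0)) ∧
        (∀ t : ℝ≥0, U t = S t U₀) ∧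
        -- regularity of the solution
        ∀ k : ℕ, U₀ ∈ (ThermoPlate.iter P.B k).domain →
          ∀ j ≤ k, ThermoPlate.IsCkInDomain (k - j) (ThermoPlate.iter P.B j) U := by
  have := P.completeSpace_phaseSpace
  exact ⟨this, P.mem_B_domain_iff, ThermoPlate.exists_semigroup_of_isDissipative_inverse
    P.mem_B_graph_iff_eq_Binv P.isDissipative_Binv⟩
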